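/- Let $F$ be a $p$-adic field (a finite extension of $\mathbb Q_p$), let $L=\widehat{F^{\rm un}}$ be the completion of its maximal unramified extension, and let $I={\rm Gal}(\bar L/L)$ be the inertia group. Let $F_r\subset L$ be the unramified extension of $F$ of degree $r\ge 1$, and let $\theta$ be a generator of ${\rm Gal}(F_r/F)$. For an $F$-torus $T$ let $\kappa_T:T(L)\to X_*(T)_I$ be the Kottwitz homomorphism: if $E/L$ is a finite Galois extension that splits $T$, with normalized valuation ${\rm ord}_E:E^\times\to\mathbb Z$, then the norm $N_{E/L}:T(E)\to T(L)$ is surjective, and $\kappa_T(N_{E/L}(t'))$ is, for each $t'\in T(E)$, the class in $X_*(T)_I=X_*(T)_{{\rm Gal}(E/L)}$ of the cocharacter $\chi\mapsto {\rm ord}_E(\chi(t'))$ in ${\rm Hom}(X^*(T),\mathbb Z)=X_*(T)$. Put $T(F)_1=T(F)\cap\ker\kappa_T$ and $T(F_r)_1=T(F_r)\cap\ker\kappa_T$. Then, for every $F$-torus $T$, the norm $N_r(t)=t\,\theta(t)\cdots\theta^{r-1}(t)$ defines a surjective homomorphism $$N_r:T(F_r)_1\longrightarrow T(F)_1.$$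 -/

import Mathlib

open scoped TensorProduct

noncomputable section

namespace PadicTorus

/-! ### Affine commutative group schemes: points, characters, cocharacters -/

section Characters

variable (F : Type*) [Field F] (A : Type*) [CommRing A] [HopfAlgebra F A]

/-- `T` is a split torus over the field extension `E` of `F`: the base change of `T` to `E` is
isomorphic, as a group scheme, to `𝔾ₘⁿ = Spec E[ℤⁿ]` for some `n`. -/
def IsSplitOver (E : Type*) [Field E] [Algebra F E] : Prop :=
  ∃ n : ℕ, Nonempty (E ⊗[F] A ≃ₐc[E] AddMonoidAlgebra E (Fin n → ℤ))

/-- `T = Spec A` is an `F`-torus: it becomes a split torus over an algebraic closure of `F`. -/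
def IsTorus : Prop := IsSplitOver F A (AlgebraicClosure F)

/-- The group `X^*(T)` of characters of `T` defined over `E`, written multiplicatively: a
homomorphism `T_E → 𝔾ₘ` is the same thing as a group-like element of the coordinate ring. -/
abbrev Char (E : Type*) [Field E] [Algebra F E] : Type _ := GroupLike E (E ⊗[F] A)

/-- The cocharacter group `X_*(T) = Hom(X^*(T), ℤ)`, for `E` a splitting field of `T`
(written multiplicatively). -/
abbrev Cochar (E : Type*) [Field E] [Algebra F E] : Type _ := Char F A E →* Multiplicative ℤ

variable {F A}
variable {E : Type*} [Field E] [Algebra F E]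

lemma isGroupLikeElem_map (g : E ≃ₐ[F] E) {x : E ⊗[F] A} (hx : IsGroupLikeElem E x) :
    IsGroupLikeElem E (Algebra.TensorProduct.map g.toAlgHom (AlgHom.id F A) x) := by
  set τ := Algebra.TensorProduct.map g.toAlgHom (AlgHom.id F A) with hτ
  have hsmul : ∀ (e : E) (y : E ⊗[F] A), τ (e • y) = g e • τ y := by
    intro e y
    induction y with
    | zero => simp
    | add y z hy hz => simp only [smul_add, map_add, hy, hz]
    | tmul e' a => simp [hτ, TensorProduct.smul_tmul']
  let τₗ : E ⊗[F] A →ₛₗ[(g : E →+* E)] E ⊗[F] A :=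
    { toFun := τ, map_add' := map_add τ, map_smul' := hsmul }
  have hcounit : ∀ y : E ⊗[F] A,
      Coalgebra.counit (R := E) (τ y) = g (Coalgebra.counit (R := E) y) := by
    intro y
    induction y with
    | zero => simp
    | add y z hy hz => simp only [map_add, hy, hz]
    | tmul e' a => simp [hτ]
  have hcomul : ∀ y : E ⊗[F] A, Coalgebra.comul (R := E) (τ y) =
      TensorProduct.map τₗ τₗ (Coalgebra.comul (R := E) y) := by
    intro y
    induction y with
    | zero => simp
    | add y z hy hz => simp only [map_add, hy, hz]
    | tmul e' a =>
      simp [hτ, τₗ, ← (Coalgebra.Repr.arbitrary F a).eq, TensorProduct.tmul_sum]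
  exact ⟨by rw [hcounit, hx.counit_eq_one, map_one], by
    rw [hcomul, hx.comul_eq_tmul_self, TensorProduct.map_tmul]; rfl⟩

/-- The action of an automorphism `g` of `E` on characters, through the coefficients. -/
def galChar (g : E ≃ₐ[F] E) : Char F A E →* Char F A E where
  toFun χ := ⟨Algebra.TensorProduct.map g.toAlgHom (AlgHom.id F A) χ.val,
    isGroupLikeElem_map g χ.2⟩
  map_one' := by
    apply GroupLike.val_injective
    simp
  map_mul' χ ψ := by
    apply GroupLike.val_injective
    simp

/-- The action of an automorphism on cocharacters: `⟨χ, g x⟩ = ⟨g⁻¹ χ, x⟩`. -/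
def galCochar (g : E ≃ₐ[F] E) (x : Cochar F A E) : Cochar F A E := x.comp (galChar g.symm)

variable (F A E)
variable (L : Type*) [Field L] [Algebra F L] [Algebra L E] [IsScalarTower F L E]

/-- The subgroup of `X_*(T)` generated by the elements `g x - x`, `g ∈ Gal(E/L)`. -/
def augmentation : Subgroup (Cochar F A E) :=
  Subgroup.closure {z | ∃ (g : E ≃ₐ[L] E) (x : Cochar F A E),
    z = galCochar (g.restrictScalars F) x / x}

/-- The coinvariants `X_*(T)_I`: if `E` splits `T`, inertia acts on `X_*(T)` through `Gal(E/L)`. -/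
abbrev Coinvariants : Type _ := Cochar F A E ⧸ augmentation F A E L

end Characters

section Points

variable (F : Type*) [Field F] (A : Type*) [CommRing A] [HopfAlgebra F A]

/-- The set `T(R)` of `R`-points of `T = Spec A`, with `A` a commutative Hopf algebra over `F`. Its
group law is the convolution product. -/
def Points (R : Type*) [CommRing R] [Algebra F R] : Type _ := WithConv (A →ₐ[F] R)

variable {F A}

/-- The commutative group structure on `T(R)`; the inverse is composition with the antipode. -/
instance [Coalgebra.IsCocomm F A] (R : Type*) [CommRing R] [Algebra F R] :
    CommGroup (Points F A R) :=
  { (inferInstance : CommMonoid (WithConv (A →ₐ[F] R))) with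
    inv := fun f => WithConv.toConv (f.ofConv.comp (HopfAlgebra.antipodeAlgHom F A))
    inv_mul_cancel := by
      intro f
      apply WithConv.ofConv_injective
      apply AlgHom.ext
      intro a
      have h := congrArg f.ofConv (HopfAlgebra.mul_antipode_rTensor_comul_apply (R := F) a)
      refine (AlgHom.convMul_apply _ _ _).trans ?_
      refine Eq.trans ?_ (AlgHom.convOne_apply (A := R) a).symm
      rw [AlgHom.commutes] at h
      rw [← h]
      generalize Coalgebra.comul (R := F) a = z
      induction z with
      | zero => simp
      | add x y hx hy => simp only [map_add, hx, hy]
      | tmul x y => simp }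

variable [Coalgebra.IsCocomm F A]

/-- The homomorphism `T(R) → T(S)` induced by an `F`-algebra homomorphism `R → S`. -/
def Points.map {R S : Type*} [CommRing R] [Algebra F R] [CommRing S] [Algebra F S]
    (f : R →ₐ[F] S) : Points F A R →* Points F A S where
  toFun t := WithConv.toConv (f.comp t.ofConv)
  map_one' := by
    apply WithConv.ofConv_injective
    apply AlgHom.ext
    intro a
    exact f.commutes _
  map_mul' x y := WithConv.ofConv_injective (AlgHom.comp_convMul_distrib f x y)

variable {E : Type*} [Field E] [Algebra F E]

/-- The `E`-algebra homomorphism `E ⊗ A → E` given by a point `t ∈ T(E)`. -/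
def evalAlgHom (t : Points F A E) : E ⊗[F] A →ₐ[E] E :=
  Algebra.TensorProduct.lift (AlgHom.id E E) t.ofConv (fun _ _ => Commute.all _ _)

lemma evalAlgHom_one (x : E ⊗[F] A) :
    evalAlgHom (1 : Points F A E) x = Coalgebra.counit (R := E) x := by
  have : evalAlgHom (1 : Points F A E) = Bialgebra.counitAlgHom E (E ⊗[F] A) := by
    ext a
    refine Eq.trans (b := algebraMap F E (Coalgebra.counit a)) ?_ ?_
    · simp only [evalAlgHom, AlgHom.comp_apply, AlgHom.restrictScalars_apply,
        Algebra.TensorProduct.includeRight_apply, Algebra.TensorProduct.lift_tmul, map_one, one_mul]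
      exact AlgHom.convOne_apply (A := E) a
    · simp [Algebra.algebraMap_eq_smul_one]
  exact DFunLike.congr_fun this x

lemma evalAlgHom_mul (s t : Points F A E) (x : E ⊗[F] A) :
    evalAlgHom (s * t) x = Algebra.TensorProduct.lift (evalAlgHom s) (evalAlgHom t)
      (fun _ _ => Commute.all _ _) (Coalgebra.comul (R := E) x) := by
  have : evalAlgHom (s * t) = (Algebra.TensorProduct.lift (evalAlgHom s) (evalAlgHom t)
      (fun _ _ => Commute.all _ _)).comp (Bialgebra.comulAlgHom E (E ⊗[F] A)) := by
    ext a
    refine Eq.trans (b := Algebra.TensorProduct.lift s.ofConv t.ofConv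
      (fun _ _ => Commute.all _ _) (Coalgebra.comul (R := F) a)) ?_ ?_
    · simp only [evalAlgHom, AlgHom.comp_apply, AlgHom.restrictScalars_apply,
        Algebra.TensorProduct.includeRight_apply, Algebra.TensorProduct.lift_tmul, map_one, one_mul]
      exact AlgHom.convMul_apply _ _ a
    · simp [← (Coalgebra.Repr.arbitrary F a).eq, TensorProduct.tmul_sum, evalAlgHom]
  exact DFunLike.congr_fun this x

/-- The value `χ(t) ∈ Eˣ` of a character at a point `t ∈ T(E)`, as a homomorphism in `t`. -/
def evalChar : Points F A E →* (Char F A E →* Eˣ) where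
  toFun t := (Units.map (evalAlgHom t).toMonoidHom).comp (GroupLike.toUnits E)
  map_one' := by
    ext χ
    exact (evalAlgHom_one χ.val).trans χ.2.counit_eq_one
  map_mul' s t := by
    ext χ
    refine (evalAlgHom_mul s t χ.val).trans ?_
    rw [χ.2.comul_eq_tmul_self, Algebra.TensorProduct.lift_tmul]
    rfl

variable (L : Type*) [Field L] [Algebra F L] [Algebra L E] [IsScalarTower F L E]

/-- The homomorphism `T(E) → X_*(T)`, `t ↦ (χ ↦ ord (χ t))`. -/
def ordPoint (ord : Eˣ →* Multiplicative ℤ) : Points F A E →* Cochar F A E where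
  toFun t := ord.comp (evalChar t)
  map_one' := by ext; simp
  map_mul' s t := by ext; simp

variable (F A E) in
/-- The norm `N_{E/L}` on `T(E)`, with values in `T(L) ⊆ T(E)`. -/
def normPoint [FiniteDimensional L E] : Points F A E →* Points F A E :=
  ∏ g : E ≃ₐ[L] E, Points.map (g.restrictScalars F).toAlgHom

/-- The graph of the Kottwitz homomorphism `κ_T : T(L) → X_*(T)_I`, in terms of a finite Galois
extension `E/L` that splits `T` and the normalized valuation `ord` of `E`. Put
`R = Res_{E/L} T_E`, an induced torus with `R(L) = T(E)`, `X_*(R)_I = X_*(T)` and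
`κ_R = ordPoint ord`; the norm `R → T` is surjective on `L`-points, and `κ_T` is the homomorphism
obtained from `κ_R` by passing to the quotient. So `κ_T (N_{E/L} t')` is the class of
`ordPoint ord t'` for every `t' ∈ T(E)`. -/
def kottwitzGraph [FiniteDimensional L E] (ord : Eˣ →* Multiplicative ℤ) :
    Subgroup (Points F A L × Coinvariants F A E L) :=
  ((normPoint F A E L).prod ((QuotientGroup.mk' (augmentation F A E L)).comp
      (ordPoint ord))).range.comap
    ((Points.map (IsScalarTower.toAlgHom F L E)).prodMap (MonoidHom.id _))

end Points

/-! ### The completed maximal unramified extension -/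

section Unramified

variable {p : ℕ} [Fact p.Prime] {F : Type*} [Field F] [Algebra F ℂ_[p]]

/-- A finite extension `K/F` inside `ℂ_p` is unramified if its ramification index is one, that is,
if it has the same value group as `F` (residue fields are finite, hence perfect). -/
def IsUnramified (K : IntermediateField F ℂ_[p]) : Prop :=
  ∀ x ∈ K, ∃ y : F, ‖x‖ = ‖algebraMap F ℂ_[p] y‖

variable (p F)

/-- The maximal unramified extension `F^un` of `F`. -/
def maxUnramified : IntermediateField F ℂ_[p] :=
  ⨆ (K : IntermediateField F ℂ_[p]) (_ : FiniteDimensional F K ∧ IsUnramified K), K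

/-- The completion `L` of `F^un`, as the closure of `F^un` in the complete field `ℂ_p`. -/
def completedUnramified : IntermediateField F ℂ_[p] :=
  { (maxUnramified p F).toSubfield.topologicalClosure with
    algebraMap_mem' := fun x => Subfield.le_topologicalClosure _
      ((maxUnramified p F).algebraMap_mem x) }

variable {p F}

lemma le_completedUnramified (K : IntermediateField F ℂ_[p]) [hK : FiniteDimensional F K]
    (h : IsUnramified K) : K ≤ completedUnramified p F := fun _ hx =>
  Subfield.le_topologicalClosure _
    ((le_iSup₂_of_le (f := fun (K : IntermediateField F ℂ_[p])
      (_ : FiniteDimensional F K ∧ IsUnramified K) => K) K ⟨hK, h⟩ le_rfl) hx)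

/-- The compositum `K L` inside `ℂ_p`, as an extension of `L`. -/
abbrev compositum (K : IntermediateField F ℂ_[p]) :
    IntermediateField (completedUnramified p F) ℂ_[p] :=
  IntermediateField.adjoin (completedUnramified p F) (K : Set ℂ_[p])

instance (K : IntermediateField F ℂ_[p]) [FiniteDimensional F K] :
    FiniteDimensional (completedUnramified p F) (compositum K) := by
  let L := completedUnramified p F
  let b := Module.finBasis F K
  let S : Set ℂ_[p] := Set.range fun i => (b i : ℂ_[p])
  have hS : compositum K = IntermediateField.adjoin L S := by
    apply le_antisymm
    · rw [IntermediateField.adjoin_le_iff]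
      intro x hx
      have h := congrArg (Subtype.val : K → ℂ_[p]) (b.sum_repr ⟨x, hx⟩)
      rw [← show _ = x from h, AddSubmonoidClass.coe_finsetSum]
      refine sum_mem fun i _ => ?_
      have hb : (b i : ℂ_[p]) ∈ IntermediateField.adjoin L S :=
        IntermediateField.subset_adjoin _ _ ⟨i, rfl⟩
      have := (IntermediateField.adjoin L S).smul_mem hb
        (x := algebraMap F L (b.repr ⟨x, hx⟩ i))
      rwa [algebraMap_smul] at this
    · rw [IntermediateField.adjoin_le_iff]
      rintro _ ⟨i, rfl⟩
      exact IntermediateField.subset_adjoin _ _ (b i).2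
  rw [hS]
  refine IntermediateField.finiteDimensional_adjoin (S := S) ?_
  rintro _ ⟨i, rfl⟩
  have h : IsIntegral F (b i : ℂ_[p]) :=
    (IsIntegral.of_finite F (b i)).map (IsScalarTower.toAlgHom F K ℂ_[p])
  exact h.tower_top

/-- `ord` is the normalized valuation of `E`: the surjective homomorphism `Eˣ → ℤ` whose kernel and
sign are those of the `p`-adic absolute value. -/
structure IsNormalizedOrd {L : Type*} [Field L] [Algebra L ℂ_[p]]
    (E : IntermediateField L ℂ_[p]) (ord : Eˣ →* Multiplicative ℤ) : Prop where
  surjective : Function.Surjective ord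
  nonneg_iff : ∀ x : Eˣ, 0 ≤ (ord x).toAdd ↔ ‖((x : E) : ℂ_[p])‖ ≤ 1

end Unramified

/-! ### The kernel of the Kottwitz homomorphism -/

section Kottwitz

variable (p : ℕ) [Fact p.Prime] (F : Type*) [Field F] [Algebra F ℂ_[p]]
  (A : Type*) [CommRing A] [HopfAlgebra F A]

/-- A finite Galois extension `K/F` that splits `T`, with the normalized valuation of `E = K L`. -/
structure SplittingDatum where
  /-- the splitting field -/
  K : IntermediateField F ℂ_[p]
  finite : FiniteDimensional F K
  galois : IsGalois F K
  split : IsSplitOver F A K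
  /-- the normalized valuation of `K L` -/
  ord : (compositum K)ˣ →* Multiplicative ℤ
  isNormalizedOrd : IsNormalizedOrd (compositum K) ord

variable [Coalgebra.IsCocomm F A]

/-- The kernel of `κ_T`, computed with a given splitting field. -/
def SplittingDatum.kottwitzKer (D : SplittingDatum p F A) :
    Subgroup (Points F A (completedUnramified p F)) :=
  haveI := D.finite
  (kottwitzGraph (completedUnramified p F) D.ord).comap (MonoidHom.inl _ _)

/-- `T(L)_1 = ker κ_T`. Since `κ_T` does not depend on the splitting field, the subgroups in the
supremum all coincide; the supremum only avoids a choice. -/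
def kottwitzKer : Subgroup (Points F A (completedUnramified p F)) :=
  ⨆ D : SplittingDatum p F A, D.kottwitzKer

variable {p F}

/-- `T(R)_1 = T(R) ∩ ker κ_T`, for a subextension `R` of `L/F` given by its embedding in `L`. -/
def pointsOne {R : Type*} [CommRing R] [Algebra F R] (i : R →ₐ[F] completedUnramified p F) :
    Subgroup (Points F A R) :=
  (kottwitzKer p F A).comap (Points.map i)

end Kottwitz

end PadicTorus

end

noncomputable section

namespace PadicTorus

/-! ### The residue field of `ℂ_p` and roots of unity of order prime to `p` -/

section Residue

variable {p : ℕ} [Fact p.Prime]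

/-! The theorem follows from a version of Lang's theorem: if `σ` is a Frobenius automorphism of
`L/F`, then every power `σ ^ r` with `r ≥ 1` makes `z ↦ σ^r(z)/z` surjective on `T(L)_1`
(`exists_map_eq_mul_of_mem`). Given `n` in `T(F)_1`, write `n = σ^r(y)/y` with `y` in `T(L)_1` and
put `x = σ(y)/y`. Since `σ` fixes `n`, `σ^r` fixes `x`, so `x` is a point over the fixed field `F_r`
of `σ^r` in `L`. The product `x σ(x) ⋯ σ^(r-1)(x)` telescopes to `σ^r(y)/y = n`. Replacing `σ` by
another generator `θ` of `Gal(F_r/F)` only permutes the factors of the norm.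

For Lang's theorem, let `K` split `T` and let `E = K L`. The kernel of `κ_T` is the image under
`N_{E/L}` of the integral points, those `t` in `T(E)` at which all characters are units
(`mem_kottwitzKer_iff`): a cocharacter `g x - x` is the valuation of some `g(u)/u`, which has norm
one, so a representative whose valuation vanishes only in the coinvariants can be corrected to an
integral one. Because the norm commutes with `σ`, it suffices to treat integral points over `E`.
Some power `φ` of the given automorphism fixes `K`, hence all characters, and then acts on `T(E) =
Hom(X^*(T), E^×)` through `E^×` alone. As `X^*(T)` is free, surjectivity of `φ - 1` on integral
points reduces to surjectivity on the units of `E` (`IsFrobeniusPower.exists_apply_eq_mul`), and a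
telescoping product passes from `φ` back to the original automorphism. On units, the equation is
solved in the algebraically closed residue field and then by successive approximation in the
complete, discretely valued field `E`.

The field theory takes place inside `ℂ_p`. Roots of unity of order prime to `p` (tame roots) serve
as Teichmüller representatives: they represent each nonzero residue class exactly once and generate
the unramified extensions. Frobenius is constructed by prescribing its action on them. -/

lemma norm_sub_le_max' (x y : ℂ_[p]) : ‖x - y‖ ≤ max ‖x‖ ‖y‖ := by
  simpa [sub_eq_add_neg] using IsUltrametricDist.norm_add_le_max x (-y)

lemma norm_sub_lt_trans {x y z : ℂ_[p]} {c : ℝ} (h : ‖x - y‖ < c) (h' : ‖y - z‖ < c) :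
    ‖x - z‖ < c := by
  have := IsUltrametricDist.norm_add_le_max (x - y) (y - z)
  rw [sub_add_sub_cancel] at this
  exact this.trans_lt (max_lt h h')

lemma norm_eq_of_norm_sub_lt {x y : ℂ_[p]} (h : ‖x - y‖ < ‖x‖) : ‖y‖ = ‖x‖ := by
  have h1 := norm_sub_le_max' x (x - y)
  have h2 := IsUltrametricDist.norm_add_le_max (x - y) y
  rw [sub_sub_cancel] at h1
  rw [sub_add_cancel] at h2
  apply le_antisymm
  · exact h1.trans (max_le le_rfl h.le)
  · rcases le_max_iff.1 h2 with h3 | h3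
    · exact absurd h (not_lt.2 h3)
    · exact h3

lemma norm_natCast_p_lt_one : ‖(p : ℂ_[p])‖ < 1 := by
  have h := PadicComplex.norm_extends' p (p : ℚ_[p])
  rw [show ((algebraMap ℚ_[p] (PadicAlgCl p) (p : ℚ_[p]) : PadicAlgCl p) : ℂ_[p]) = (p : ℂ_[p])
    by simp] at h
  rw [h]
  exact Padic.norm_p_lt_one

lemma norm_natCast_eq_one {N : ℕ} (hN : p.Coprime N) : ‖(N : ℂ_[p])‖ = 1 := by
  have h := PadicComplex.norm_extends' p (N : ℚ_[p])
  rw [show ((algebraMap ℚ_[p] (PadicAlgCl p) (N : ℚ_[p]) : PadicAlgCl p) : ℂ_[p]) = (N : ℂ_[p])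
    by simp] at h
  rw [h]
  exact Padic.norm_natCast_eq_one_iff.2 hN

lemma ne_zero_of_coprime {N : ℕ} (hN : p.Coprime N) : N ≠ 0 := by
  rintro rfl
  exact (Fact.out : p.Prime).one_lt.ne' (by simpa using hN)

variable (p) in
/-- The ring of integers of `ℂ_p`. -/
abbrev Integers : ValuationSubring ℂ_[p] := (NormedField.valuation (K := ℂ_[p])).valuationSubring

lemma mem_integers {x : ℂ_[p]} : x ∈ Integers p ↔ ‖x‖ ≤ 1 := by
  rw [Valuation.mem_valuationSubring_iff, NormedField.valuation_apply]
  exact Iff.rfl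

variable (p) in
/-- The residue field of `ℂ_p`. -/
abbrev Residue : Type := IsLocalRing.ResidueField (Integers p)

lemma residue_eq_zero {a : Integers p} :
    IsLocalRing.residue (Integers p) a = 0 ↔ ‖(a : ℂ_[p])‖ < 1 := by
  rw [IsLocalRing.residue_eq_zero_iff, ValuationSubring.valuation_lt_one_iff,
    ← (Valuation.isEquiv_valuation_valuationSubring _).lt_one_iff_lt_one,
    NormedField.valuation_apply]
  exact Iff.rfl

lemma residue_eq {a b : Integers p} :
    IsLocalRing.residue (Integers p) a = IsLocalRing.residue (Integers p) b ↔
      ‖(a : ℂ_[p]) - b‖ < 1 := by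
  rw [← sub_eq_zero, ← map_sub, residue_eq_zero]
  rfl

instance : CharP (Residue p) p := by
  refine (CharP.charP_iff_prime_eq_zero Fact.out).2 ?_
  rw [← map_natCast (IsLocalRing.residue (Integers p)), residue_eq_zero]
  simpa using norm_natCast_p_lt_one

lemma norm_pow_sub_pow_lt_one {x y : ℂ_[p]} (hx : ‖x‖ ≤ 1) (hy : ‖y‖ ≤ 1) (h : ‖x - y‖ < 1)
    (n : ℕ) : ‖x ^ n - y ^ n‖ < 1 := by
  have h' : IsLocalRing.residue (Integers p) ⟨x, mem_integers.2 hx⟩ =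
    IsLocalRing.residue (Integers p) ⟨y, mem_integers.2 hy⟩ := residue_eq.2 h
  have := congrArg (· ^ n) h'
  simp only [← map_pow] at this
  exact residue_eq.1 this

lemma norm_le_one_of_norm_sub_lt_one {x y : ℂ_[p]} (hx : ‖x‖ ≤ 1) (h : ‖x - y‖ < 1) :
    ‖y‖ ≤ 1 := by
  have h1 := norm_sub_le_max' x (x - y)
  rw [sub_sub_cancel] at h1
  exact h1.trans (max_le hx h.le)

/-- A root of unity of order prime to `p`. -/
def IsTameRoot (ζ : ℂ_[p]) : Prop := ∃ N : ℕ, p.Coprime N ∧ ζ ^ N = 1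

lemma norm_eq_one_of_pow {ζ : ℂ_[p]} {N : ℕ} (hN : N ≠ 0) (h : ζ ^ N = 1) : ‖ζ‖ = 1 := by
  have := congrArg norm h
  rw [norm_pow, norm_one] at this
  exact (pow_eq_one_iff_of_nonneg (norm_nonneg _) hN).1 this

lemma IsTameRoot.norm {ζ : ℂ_[p]} (h : IsTameRoot ζ) : ‖ζ‖ = 1 := by
  obtain ⟨N, hN, h⟩ := h
  exact norm_eq_one_of_pow (ne_zero_of_coprime hN) h

lemma IsTameRoot.pow {ζ : ℂ_[p]} (h : IsTameRoot ζ) (n : ℕ) : IsTameRoot (ζ ^ n) := by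
  obtain ⟨N, hN, h⟩ := h
  exact ⟨N, hN, by rw [← pow_mul, mul_comm, pow_mul, h, one_pow]⟩

lemma IsTameRoot.ne_zero {ζ : ℂ_[p]} (h : IsTameRoot ζ) : ζ ≠ 0 :=
  norm_ne_zero_iff.1 (by rw [h.norm]; exact one_ne_zero)

/-- Roots of unity of order prime to `p` are determined by their reductions. -/
lemma IsTameRoot.eq_of_norm_sub_lt_one {ζ ξ : ℂ_[p]} (hζ : IsTameRoot ζ) (hξ : IsTameRoot ξ)
    (h : ‖ζ - ξ‖ < 1) : ζ = ξ := by
  obtain ⟨N, hN, hζN⟩ := id hζ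
  obtain ⟨M, hM, hξM⟩ := id hξ
  have h0 := hξ.ne_zero
  set w := ζ / ξ with hw
  have hwN : w ^ (N * M) = 1 := by
    rw [hw, div_pow, pow_mul, hζN, one_pow, mul_comm, pow_mul, hξM, one_pow, div_one]
  have hw1 : ‖w - 1‖ < 1 := by
    rw [hw, div_sub_one h0, norm_div, hξ.norm, div_one]
    exact h
  have hNM : p.Coprime (N * M) := Nat.Coprime.mul_right hN hM
  have hwn : ‖w‖ ≤ 1 := (norm_eq_one_of_pow (ne_zero_of_coprime hNM) hwN).le
  suffices w = 1 by rwa [hw, div_eq_one_iff_eq h0] at this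
  by_contra hne
  -- If `w ≠ 1`, the geometric sum vanishes. Its reduction is `N * M`, because `w` reduces to one,
  -- and this is nonzero as `p` does not divide `N * M`.
  have hgeom : ∑ i ∈ Finset.range (N * M), w ^ i = 0 := by
    have := mul_geom_sum w (N * M)
    rw [hwN, sub_self] at this
    exact (mul_eq_zero.1 this).resolve_left (sub_ne_zero.2 hne)
  have hr := congrArg (IsLocalRing.residue (Integers p)) (show
    ∑ i ∈ Finset.range (N * M), (⟨w, mem_integers.2 hwn⟩ : Integers p) ^ i = 0 by
      apply Subtype.ext
      push_cast
      exact hgeom)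
  have hw' : IsLocalRing.residue (Integers p) ⟨w, mem_integers.2 hwn⟩ = 1 := by
    rw [← map_one (IsLocalRing.residue (Integers p)), residue_eq]
    exact hw1
  rw [map_sum] at hr
  simp only [map_pow, hw', one_pow, Finset.sum_const, Finset.card_range, nsmul_eq_mul, mul_one,
    map_zero] at hr
  rw [← map_natCast (IsLocalRing.residue (Integers p)), residue_eq_zero] at hr
  have := norm_natCast_eq_one hNM
  simp only [SubringClass.coe_natCast, this, lt_self_iff_false] at hr

/-- The `p`-power map contracts residue discs. -/
lemma norm_pow_p_sub_le {x y : ℂ_[p]} (hx : ‖x‖ ≤ 1) (hy : ‖y‖ ≤ 1) {c : ℝ}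
    (hp : ‖(p : ℂ_[p])‖ ≤ c) (hc : ‖x - y‖ ≤ c) : ‖x ^ p - y ^ p‖ ≤ c * ‖x - y‖ := by
  have hδ1 : ‖x - y‖ ≤ 1 := (norm_sub_le_max' x y).trans (max_le hx hy)
  set δ := x - y with hδ
  have key := add_pow_prime_eq (Fact.out : p.Prime) y δ
  set S := ∑ k ∈ Finset.Ioo 0 p, y ^ (k - 1) * δ ^ (p - k - 1) * ((p.choose k / p : ℕ) : ℂ_[p])
  have hS : ‖S‖ ≤ 1 := by
    apply IsUltrametricDist.norm_sum_le_of_forall_le_of_nonneg zero_le_one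
    intro k _
    rw [norm_mul, norm_mul, norm_pow, norm_pow]
    exact mul_le_one₀ (mul_le_one₀ (pow_le_one₀ (norm_nonneg _) hy) (by positivity)
      (pow_le_one₀ (norm_nonneg _) hδ1)) (norm_nonneg _)
      (IsUltrametricDist.norm_natCast_le_one _ _)
  have hxy : x ^ p - y ^ p = δ ^ p + p * y * δ * S := by
    rw [show x = y + δ by rw [hδ]; ring, key]; ring
  have hc0 : 0 ≤ c := (norm_nonneg _).trans hp
  rw [hxy]
  refine (IsUltrametricDist.norm_add_le_max _ _).trans (max_le ?_ ?_)
  · obtain ⟨n, hn⟩ : ∃ n, p = n + 2 := ⟨p - 2, by have := (Fact.out : p.Prime).two_le; omega⟩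
    have hpow : ‖δ‖ ^ p = (‖δ‖ ^ n * ‖δ‖) * ‖δ‖ := by
      rw [mul_assoc, ← pow_two, ← pow_add]
      exact congrArg _ hn
    rw [norm_pow, hpow]
    refine mul_le_mul_of_nonneg_right ?_ (norm_nonneg _)
    exact (mul_le_of_le_one_left (norm_nonneg _) (pow_le_one₀ (norm_nonneg _) hδ1)).trans hc
  · rw [norm_mul, norm_mul, norm_mul]
    calc ‖(p : ℂ_[p])‖ * ‖y‖ * ‖δ‖ * ‖S‖ ≤ ‖(p : ℂ_[p])‖ * ‖y‖ * ‖δ‖ * 1 := by gcongr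
      _ ≤ c * 1 * ‖δ‖ * 1 := by gcongr
      _ = c * ‖δ‖ := by ring

/-- The contraction factor `c = max ‖p‖ ‖x - y‖` stays valid at each step because the distances
never increase, so the convergence is geometric. -/
lemma tendsto_pow_p_pow_sub {x y : ℂ_[p]} (hx : ‖x‖ ≤ 1) (hy : ‖y‖ ≤ 1) (h : ‖x - y‖ < 1) :
    Filter.Tendsto (fun k : ℕ => x ^ p ^ k - y ^ p ^ k) Filter.atTop (nhds 0) := by
  set c := max ‖(p : ℂ_[p])‖ ‖x - y‖ with hc
  have hc1 : c < 1 := max_lt norm_natCast_p_lt_one h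
  have hc0 : 0 ≤ c := (norm_nonneg _).trans (le_max_left _ _)
  have key : ∀ k : ℕ, ‖x ^ p ^ k - y ^ p ^ k‖ ≤ c ^ k * ‖x - y‖ := by
    intro k
    induction k with
    | zero => simp
    | succ k ih =>
      have h1 : ‖x ^ p ^ k‖ ≤ 1 := by rw [norm_pow]; exact pow_le_one₀ (norm_nonneg _) hx
      have h2 : ‖y ^ p ^ k‖ ≤ 1 := by rw [norm_pow]; exact pow_le_one₀ (norm_nonneg _) hy
      rw [pow_succ p, pow_mul, pow_mul]
      refine (norm_pow_p_sub_le h1 h2 (le_max_left _ _ : _ ≤ c) (ih.trans ?_)).trans ?_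
      · exact (mul_le_of_le_one_left (norm_nonneg _) (pow_le_one₀ hc0 hc1.le)).trans
          (le_max_right _ _)
      · rw [pow_succ', mul_assoc]
        exact mul_le_mul_of_nonneg_left ih hc0
  refine squeeze_zero_norm key ?_
  simpa using (tendsto_pow_atTop_nhds_zero_of_lt_one hc0 hc1).mul_const ‖x - y‖

/-- Teichmüller representatives: a closed subfield contains the roots of unity of order prime to
`p` that are congruent to one of its elements. -/
lemma IsTameRoot.mem_of_isClosed {ζ : ℂ_[p]} (hζ : IsTameRoot ζ) {M : Subfield ℂ_[p]}
    (hM : IsClosed (M : Set ℂ_[p])) {x : ℂ_[p]} (hx : x ∈ M) (h : ‖x - ζ‖ < 1) : ζ ∈ M := by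
  have hx1 : ‖x‖ ≤ 1 := norm_le_one_of_norm_sub_lt_one hζ.norm.le (by rwa [norm_sub_rev])
  obtain ⟨N, hN, hζN⟩ := id hζ
  -- By Euler's theorem `ζ` is unchanged by the powers `p ^ (φ(N) k)`, so the corresponding powers
  -- of `x` converge to `ζ`.
  have hp : p ^ N.totient ≡ 1 [MOD N] := Nat.ModEq.pow_totient hN
  have hpk : ∀ k : ℕ, ζ ^ p ^ (N.totient * k) = ζ := by
    intro k
    have h1 : p ^ (N.totient * k) ≡ 1 [MOD N] := by
      rw [pow_mul]; simpa using hp.pow k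
    have h2 : p ^ (N.totient * k) % orderOf ζ = 1 % orderOf ζ :=
      h1.of_dvd (orderOf_dvd_of_pow_eq_one hζN)
    rw [← pow_mod_orderOf, h2, pow_mod_orderOf, pow_one]
  have htend := tendsto_pow_p_pow_sub hx1 hζ.norm.le h
  have hN0 : N.totient ≠ 0 := (Nat.totient_pos.2 (ne_zero_of_coprime hN).bot_lt).ne'
  have htop : Filter.Tendsto (fun k : ℕ => N.totient * k) Filter.atTop Filter.atTop :=
    Filter.tendsto_id.const_mul_atTop' hN0.bot_lt
  have h1 := (htend.comp htop).add_const ζ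
  rw [zero_add] at h1
  refine hM.mem_of_tendsto h1 (Filter.Eventually.of_forall fun k => ?_)
  simp only [Function.comp_apply, hpk k, sub_add_cancel]
  exact pow_mem hx _

open Polynomial in
-- `P(x)` is the product of the differences `x - ζ` over the roots, so one factor must be small. In
-- an algebraically closed field this replaces Hensel's lemma.
lemma exists_root_norm_sub_lt_one {P : Polynomial ℂ_[p]} (hP : P.Monic) {x : ℂ_[p]}
    (hx : ‖P.eval x‖ < 1) : ∃ ζ ∈ P.roots, ‖x - ζ‖ < 1 := by
  have heval := congrArg (fun P => ‖Polynomial.eval x P‖)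
    ((IsAlgClosed.splits P).eq_prod_roots_of_monic hP)
  simp only [eval_multiset_prod, Multiset.map_map] at heval
  by_contra! hcon
  have : (1 : ℝ) ≤ ‖(P.roots.map (Polynomial.eval x ∘ fun a => X - C a)).prod‖ := by
    generalize P.roots = S at hcon
    induction S using Multiset.induction_on with
    | empty => simp
    | cons a S ih =>
      rw [Multiset.map_cons, Multiset.prod_cons, norm_mul]
      refine one_le_mul_of_one_le_of_one_le ?_ (ih fun ζ hζ => hcon ζ
        (Multiset.mem_cons_of_mem hζ))
      simpa using hcon a (Multiset.mem_cons_self _ _)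
  rw [← heval] at this
  exact absurd hx (not_lt.2 this)

/-- Every unit of the ring of integers is congruent to a root of unity of order prime to `p`. -/
lemma exists_isTameRoot {x : ℂ_[p]} (hx : ‖x‖ = 1) : ∃ ζ, IsTameRoot ζ ∧ ‖x - ζ‖ < 1 := by
  -- Density makes it possible to replace `x` by an algebraic element, whose powers lie in a
  -- finite-dimensional, hence locally compact, space.
  obtain ⟨b, hb⟩ : ∃ b : PadicAlgCl p, ‖x - (b : ℂ_[p])‖ < 1 := by
    obtain ⟨_, ⟨b, rfl⟩, hb⟩ := Metric.mem_closure_iff.1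
      (UniformSpace.Completion.denseRange_coe (α := PadicAlgCl p) x) 1 one_pos
    exact ⟨b, by rwa [dist_eq_norm] at hb⟩
  have hb1 : ‖(b : ℂ_[p])‖ = 1 := by rw [norm_eq_of_norm_sub_lt (x := x) (by rwa [hx]), hx]
  set β : ℂ_[p] := (b : ℂ_[p]) with hβ
  have hint : IsIntegral ℚ_[p] β :=
    (Algebra.IsIntegral.isIntegral (R := ℚ_[p]) b).map
      (IsScalarTower.toAlgHom ℚ_[p] (PadicAlgCl p) ℂ_[p])
  let M := Algebra.adjoin ℚ_[p] {β}
  have : FiniteDimensional ℚ_[p] M :=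
    (Submodule.fg_iff_finiteDimensional _).1 (hint.fg_adjoin_singleton)
  have : FiniteDimensional ℚ_[p] (Subalgebra.toSubmodule M) := this
  have : ProperSpace (Subalgebra.toSubmodule M) := FiniteDimensional.proper ℚ_[p] _
  have hβM : ∀ n, β ^ n ∈ Subalgebra.toSubmodule M := fun n =>
    pow_mem (Algebra.subset_adjoin (Set.mem_singleton β)) n
  let u : ℕ → Subalgebra.toSubmodule M := fun k => ⟨β ^ p ^ k, hβM _⟩
  have hu : ∀ k, u k ∈ Metric.closedBall (0 : Subalgebra.toSubmodule M) 1 := by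
    intro k
    rw [mem_closedBall_zero_iff]
    change ‖β ^ p ^ k‖ ≤ 1
    rw [norm_pow, hb1, one_pow]
  obtain ⟨a, -, φ, hφ, hlim⟩ := (isCompact_closedBall _ _).tendsto_subseq hu
  obtain ⟨n₀, hn₀⟩ := Metric.cauchySeq_iff'.1 hlim.cauchySeq 1 one_pos
  have hlt : ‖β ^ p ^ φ (n₀ + 1) - β ^ p ^ φ n₀‖ < 1 := by
    have := hn₀ (n₀ + 1) (Nat.le_succ _)
    rwa [Subtype.dist_eq, dist_eq_norm] at this
  obtain ⟨d, hd⟩ : ∃ d, φ (n₀ + 1) = (d + 1) + φ n₀ :=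
    ⟨φ (n₀ + 1) - φ n₀ - 1, by have := hφ (Nat.lt_add_one n₀); omega⟩
  -- Two terms of a convergent subsequence of `β ^ p ^ k` are congruent. Frobenius is injective on
  -- the residue field, so the smaller power can be cancelled, leaving a residue fixed by the power
  -- `p ^ (d + 1)`.
  let βO : Integers p := ⟨β, mem_integers.2 hb1.le⟩
  have hres : (IsLocalRing.residue (Integers p) βO) ^ p ^ (d + 1) =
      IsLocalRing.residue (Integers p) βO := by
    have h1 : IsLocalRing.residue (Integers p) (βO ^ p ^ φ (n₀ + 1)) =
      IsLocalRing.residue (Integers p) (βO ^ p ^ φ n₀) := residue_eq.2 (by exact_mod_cast hlt)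
    rw [hd, pow_add, pow_mul, map_pow, map_pow, map_pow] at h1
    exact iterateFrobenius_inj (Residue p) p (φ n₀)
      (by simpa only [iterateFrobenius_def] using h1)
  have hN1 : 1 ≤ p ^ (d + 1) := Nat.one_le_pow _ _ (Fact.out : p.Prime).pos
  set N := p ^ (d + 1) - 1 with hN
  have hNp : p ^ (d + 1) = N + 1 := by omega
  have hcop : p.Coprime N := by
    have h1 : p ∣ N + 1 := hNp ▸ dvd_pow_self p (Nat.succ_ne_zero d)
    exact Nat.Coprime.coprime_dvd_left h1 (by simp)
  have hN0 := ne_zero_of_coprime hcop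
  have hβ0 : IsLocalRing.residue (Integers p) βO ≠ 0 := by
    rw [Ne, residue_eq_zero]
    exact not_lt.2 hb1.ge
  have hlt' : ‖β ^ N - 1‖ < 1 := by
    have h1 : IsLocalRing.residue (Integers p) (βO ^ N) = IsLocalRing.residue (Integers p) 1 := by
      rw [map_pow, map_one]
      rw [hNp, pow_succ] at hres
      exact mul_right_cancel₀ hβ0 (by rw [hres, one_mul])
    exact_mod_cast residue_eq.1 h1
  obtain ⟨ζ, hζ, hβζ⟩ := exists_root_norm_sub_lt_one
    (Polynomial.monic_X_pow_sub_C (1 : ℂ_[p]) hN0) (x := β) (by simpa using hlt')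
  refine ⟨ζ, ⟨N, hcop, ?_⟩, norm_sub_lt_trans hb hβζ⟩
  have := Polynomial.isRoot_of_mem_roots hζ
  simpa [sub_eq_zero] using this

lemma exists_coe_of_isIntegral {x : ℂ_[p]} (hx : IsIntegral ℚ_[p] x) :
    ∃ b : PadicAlgCl p, (b : ℂ_[p]) = x := by
  have hs := IsAlgClosed.splits ((minpoly ℚ_[p] x).map (algebraMap ℚ_[p] (PadicAlgCl p)))
  have hx0 : (((minpoly ℚ_[p] x).map (algebraMap ℚ_[p] (PadicAlgCl p))).map
      (algebraMap (PadicAlgCl p) ℂ_[p])).eval x = 0 := by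
    rw [Polynomial.map_map, ← IsScalarTower.algebraMap_eq, Polynomial.eval_map_algebraMap,
      minpoly.aeval]
  have h0 : ((minpoly ℚ_[p] x).map (algebraMap ℚ_[p] (PadicAlgCl p))) ≠ 0 :=
    Polynomial.map_ne_zero (minpoly.ne_zero hx)
  have := hs.mem_range_of_isRoot h0 (i := algebraMap (PadicAlgCl p) ℂ_[p]) (by
    rw [Polynomial.IsRoot.def]; exact hx0)
  exact this

/-- The absolute value of an algebraic element depends only on its minimal polynomial. -/
lemma norm_eq_of_minpoly_eq {x y : ℂ_[p]} (hx : IsIntegral ℚ_[p] x) (hy : IsIntegral ℚ_[p] y)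
    (h : minpoly ℚ_[p] x = minpoly ℚ_[p] y) : ‖x‖ = ‖y‖ := by
  obtain ⟨a, rfl⟩ := exists_coe_of_isIntegral hx
  obtain ⟨b, rfl⟩ := exists_coe_of_isIntegral hy
  have hinj := (algebraMap (PadicAlgCl p) ℂ_[p]).injective
  rw [PadicComplex.coe_eq, PadicComplex.coe_eq, minpoly.algebraMap_eq hinj,
    minpoly.algebraMap_eq hinj] at h
  rw [PadicComplex.norm_extends, PadicComplex.norm_extends, ← PadicAlgCl.spectralNorm_eq,
    ← PadicAlgCl.spectralNorm_eq, spectralNorm, spectralNorm, h]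

end Residue

/-! ### Finite extensions of a `p`-adic field inside `ℂ_p` -/

section Polynomials

variable {p : ℕ} [Fact p.Prime]

open Polynomial in
-- `lifts` is closed under products, so a monic polynomial with integral roots is seen to have
-- integral coefficients from its linear factors.
lemma X_sub_C_mem_lifts {x : ℂ_[p]} (hx : ‖x‖ ≤ 1) :
    X - C x ∈ lifts (Integers p).subtype :=
  ⟨X - C ⟨x, mem_integers.2 hx⟩, by simp⟩

open Polynomial in
lemma norm_coeff_le_one_of_mem_lifts {P : Polynomial ℂ_[p]} (hP : P ∈ lifts (Integers p).subtype)
    (i : ℕ) : ‖P.coeff i‖ ≤ 1 := by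
  obtain ⟨Q, rfl⟩ := hP
  simpa using mem_integers.1 (Q.coeff i).2

end Polynomials

section Subfields

variable {p : ℕ} [Fact p.Prime] {F : Type*} [Field F] [Algebra ℚ_[p] F]
    [FiniteDimensional ℚ_[p] F] [Algebra F ℂ_[p]] [IsScalarTower ℚ_[p] F ℂ_[p]]

/-- The `ℚ_p`-vector space underlying a subfield of `ℂ_p`. -/
abbrev toQpSubmodule (M : IntermediateField F ℂ_[p]) : Submodule ℚ_[p] ℂ_[p] :=
  (Subalgebra.toSubmodule M.toSubalgebra).restrictScalars ℚ_[p]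

lemma finiteDimensional_toQpSubmodule (M : IntermediateField F ℂ_[p]) [FiniteDimensional F M] :
    FiniteDimensional ℚ_[p] (toQpSubmodule M) :=
  FiniteDimensional.trans ℚ_[p] F M

lemma isClosed_of_finiteDimensional (M : IntermediateField F ℂ_[p]) [FiniteDimensional F M] :
    IsClosed (M : Set ℂ_[p]) := by
  have := finiteDimensional_toQpSubmodule M
  exact (toQpSubmodule M).closed_of_finiteDimensional

lemma properSpace_toQpSubmodule (M : IntermediateField F ℂ_[p]) [FiniteDimensional F M] :
    ProperSpace (toQpSubmodule M) := by
  have := finiteDimensional_toQpSubmodule M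
  exact FiniteDimensional.proper ℚ_[p] _

lemma isIntegral_of_mem {M : IntermediateField F ℂ_[p]} [FiniteDimensional F M] {x : ℂ_[p]}
    (hx : x ∈ M) : IsIntegral ℚ_[p] x := by
  have h : IsIntegral F x :=
    (IsIntegral.of_finite F (⟨x, hx⟩ : M)).map (IsScalarTower.toAlgHom F M ℂ_[p])
  exact isIntegral_trans (R := ℚ_[p]) x h

/-- A finite extension is a proper metric space, and the distance to `x` tends to infinity along it,
so the minimum is attained. -/
lemma exists_closest (M : IntermediateField F ℂ_[p]) [FiniteDimensional F M] (x : ℂ_[p]) :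
    ∃ y ∈ M, ∀ z ∈ M, ‖x - y‖ ≤ ‖x - z‖ := by
  have := properSpace_toQpSubmodule M
  have hc : Continuous fun y : toQpSubmodule M => ‖x - (y : ℂ_[p])‖ := by fun_prop
  obtain ⟨y, hy⟩ := hc.exists_forall_le (by
    refine Filter.tendsto_atTop_mono (f := fun y : toQpSubmodule M => ‖y‖ - ‖x‖) ?_
      (Filter.tendsto_atTop_add_const_right _ _ (tendsto_norm_cocompact_atTop))
    intro y
    have := norm_sub_norm_le (y : ℂ_[p]) x
    rw [norm_sub_rev] at this
    exact this)
  exact ⟨y, y.2, fun z hz => hy ⟨z, hz⟩⟩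

/-- If every normalized element of the form `x - y`, `y ∈ M`, is congruent to an element of `M`,
then `x ∈ M`. -/
lemma mem_of_approx (M : IntermediateField F ℂ_[p]) [FiniteDimensional F M] {x : ℂ_[p]}
    (hval : ∀ y ∈ M, ∃ c ∈ M, ‖x - y‖ = ‖c‖)
    (happ : ∀ y ∈ M, ∀ c ∈ M, ‖c * (x - y)‖ = 1 → ∃ z ∈ M, ‖c * (x - y) - z‖ < 1) : x ∈ M := by
  obtain ⟨y, hy, hmin⟩ := exists_closest M x
  by_cases h0 : x - y = 0
  · rwa [sub_eq_zero.1 h0]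
  exfalso
  obtain ⟨c, hc, hxc⟩ := hval y hy
  have hc0 : c ≠ 0 := norm_ne_zero_iff.1 (by rw [← hxc]; exact norm_ne_zero_iff.2 h0)
  have h1 : ‖c⁻¹ * (x - y)‖ = 1 := by
    rw [norm_mul, norm_inv, hxc, inv_mul_cancel₀ (norm_ne_zero_iff.2 hc0)]
  -- If the minimal distance `‖c‖` were nonzero, `y + c * z` would be strictly closer to `x` than
  -- `y`.
  obtain ⟨z, hz, hlt⟩ := happ y hy c⁻¹ (inv_mem hc) h1
  have h2 := hmin (y + c * z) (add_mem hy (mul_mem hc hz))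
  have h3 : x - (y + c * z) = c * (c⁻¹ * (x - y) - z) := by field_simp; ring
  rw [h3, norm_mul, hxc] at h2
  have h4 : ‖c‖ * ‖c⁻¹ * (x - y) - z‖ < ‖c‖ * 1 :=
    mul_lt_mul_of_pos_left hlt (norm_pos_iff.2 hc0)
  rw [mul_one] at h4
  exact absurd h2 (not_le.2 h4)

/-- The residue field of a subfield of `ℂ_p`. -/
def residueSubfield (M : Subfield ℂ_[p]) : Subfield (Residue p) where
  __ := (M.toSubring.comap (Integers p).subtype).map (IsLocalRing.residue (Integers p))
  inv_mem' := by
    rintro _ ⟨x, hx, rfl⟩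
    by_cases h0 : IsLocalRing.residue (Integers p) x = 0
    · exact ⟨0, zero_mem M, by rw [h0, inv_zero, map_zero]⟩
    have hx1 : ‖(x : ℂ_[p])‖ = 1 := by
      rw [residue_eq_zero, not_lt] at h0
      exact le_antisymm (mem_integers.1 x.2) h0
    have hx0 : (x : ℂ_[p]) ≠ 0 := norm_ne_zero_iff.1 (by rw [hx1]; exact one_ne_zero)
    refine ⟨⟨(x : ℂ_[p])⁻¹, mem_integers.2 (by rw [norm_inv, hx1, inv_one])⟩, M.inv_mem hx, ?_⟩
    refine eq_inv_of_mul_eq_one_left ?_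
    rw [← map_mul, ← map_one (IsLocalRing.residue (Integers p))]
    congr 1
    exact Subtype.ext (inv_mul_cancel₀ hx0)

/-- The residue field of a finite extension of `F` inside `ℂ_p`. -/
abbrev resField (M : IntermediateField F ℂ_[p]) : Subfield (Residue p) :=
  residueSubfield M.toSubfield

/-- The closed unit ball of `M` is compact, hence covered by finitely many open unit balls, and each
of these lies in a single residue class. -/
lemma finite_resField (M : IntermediateField F ℂ_[p]) [FiniteDimensional F M] :
    Finite (resField M) := by
  have := properSpace_toQpSubmodule M
  obtain ⟨t, ht, htf, hcov⟩ := (isCompact_closedBall (0 : toQpSubmodule M) 1).finite_cover_balls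
    one_pos
  have hsub : ((resField M : Subfield (Residue p)) : Set (Residue p)) ⊆
      (fun y : toQpSubmodule M => if h : ‖(y : ℂ_[p])‖ ≤ 1 then
        IsLocalRing.residue (Integers p) ⟨y, mem_integers.2 h⟩ else 0) '' t := by
    rintro _ ⟨x, hx, rfl⟩
    have hx1 := mem_integers.1 x.2
    have := hcov (show (⟨x, hx⟩ : toQpSubmodule M) ∈ Metric.closedBall 0 1 by
      rw [mem_closedBall_zero_iff]; exact hx1)
    simp only [Set.mem_iUnion, Metric.mem_ball] at this
    obtain ⟨y, hy, hxy⟩ := this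
    have hy1 : ‖(y : ℂ_[p])‖ ≤ 1 := mem_closedBall_zero_iff.1 (ht hy)
    refine ⟨y, hy, ?_⟩
    simp only [dif_pos hy1]
    rw [residue_eq, norm_sub_rev]
    rwa [Subtype.dist_eq, dist_eq_norm] at hxy
  exact (htf.image _).subset hsub

/-- The cardinality of the residue field. -/
def resCard (M : IntermediateField F ℂ_[p]) : ℕ := Nat.card (resField M)

lemma pow_resCard (M : IntermediateField F ℂ_[p]) [FiniteDimensional F M] {a : Residue p}
    (ha : a ∈ resField M) : a ^ resCard M = a := by
  have := finite_resField M
  have := Fintype.ofFinite (resField M)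
  have h := FiniteField.pow_card (⟨a, ha⟩ : resField M)
  rw [resCard, Nat.card_eq_fintype_card]
  exact congrArg Subtype.val h

/-- `X ^ q - X` already has `q` roots in the residue field of `M`, so it has no others in a larger
field. -/
lemma mem_resField_of_pow (M : IntermediateField F ℂ_[p]) [FiniteDimensional F M] {a : Residue p}
    (ha : a ^ resCard M = a) : a ∈ resField M := by
  have := finite_resField M
  have := Fintype.ofFinite (resField M)
  rw [resCard, Nat.card_eq_fintype_card] at ha
  have hroots := FiniteField.roots_X_pow_card_sub_X (resField M)
  have hs : (Polynomial.X ^ Fintype.card (resField M) - Polynomial.X :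
      Polynomial (resField M)).Splits := by
    rw [Polynomial.splits_iff_card_roots, hroots,
      FiniteField.X_pow_card_sub_X_natDegree_eq _ Fintype.one_lt_card]
    rfl
  have h0 := FiniteField.X_pow_card_sub_X_ne_zero (resField M)
    (Fintype.one_lt_card (α := resField M))
  have := hs.mem_range_of_isRoot h0 (i := (resField M).subtype) (x := a) (by
    simp [Polynomial.IsRoot.def, ha])
  simpa using this

lemma exists_resCard_eq_pow (M : IntermediateField F ℂ_[p]) [FiniteDimensional F M] :
    ∃ f : ℕ, f ≠ 0 ∧ resCard M = p ^ f := by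
  have := finite_resField M
  have := Fintype.ofFinite (resField M)
  have : CharP (resField M) p := (resField M).subtype.charP (resField M).subtype.injective p
  obtain ⟨n, -, hn⟩ := FiniteField.card (resField M) p
  exact ⟨n, n.ne_zero, by rw [resCard, Nat.card_eq_fintype_card, hn]⟩

lemma one_lt_resCard (M : IntermediateField F ℂ_[p]) [FiniteDimensional F M] : 1 < resCard M := by
  obtain ⟨f, hf, h⟩ := exists_resCard_eq_pow M
  rw [h]
  exact Nat.one_lt_pow hf (Fact.out : p.Prime).one_lt

lemma resCard_pow_of_le {M M' : IntermediateField F ℂ_[p]} [FiniteDimensional F M]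
    [FiniteDimensional F M'] (h : M ≤ M') : ∃ s : ℕ, s ≠ 0 ∧ resCard M' = resCard M ^ s := by
  have hle : resField M ≤ resField M' := by
    rintro _ ⟨x, hx, rfl⟩
    exact ⟨x, h hx, rfl⟩
  have := finite_resField M
  have := finite_resField M'
  have := Fintype.ofFinite (resField M)
  have := Fintype.ofFinite (resField M')
  let _ : Algebra (resField M) (resField M') := (Subfield.inclusion hle).toAlgebra
  refine ⟨Module.finrank (resField M) (resField M'), ?_, ?_⟩
  · exact (Module.finrank_pos).ne'
  · rw [resCard, resCard, Nat.card_eq_fintype_card, Nat.card_eq_fintype_card]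
    exact Module.card_eq_pow_finrank

lemma norm_pow_resCard_sub_lt_one (M : IntermediateField F ℂ_[p]) [FiniteDimensional F M]
    {x : ℂ_[p]} (hx : x ∈ M) (hx1 : ‖x‖ ≤ 1) : ‖x ^ resCard M - x‖ < 1 := by
  have h := pow_resCard M (a := IsLocalRing.residue (Integers p) ⟨x, mem_integers.2 hx1⟩)
    ⟨⟨x, mem_integers.2 hx1⟩, hx, rfl⟩
  rw [← map_pow] at h
  exact residue_eq.1 h

/-- Membership can be tested on residues: tame roots are determined by their reductions, and the
closed field `M` contains the Teichmüller lifts of its residues. -/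
lemma IsTameRoot.mem_iff (M : IntermediateField F ℂ_[p]) [FiniteDimensional F M] {ζ : ℂ_[p]}
    (hζ : IsTameRoot ζ) : ζ ∈ M ↔ ζ ^ resCard M = ζ := by
  constructor
  · intro h
    exact (hζ.pow _).eq_of_norm_sub_lt_one hζ (norm_pow_resCard_sub_lt_one M h hζ.norm.le)
  · intro h
    have h1 : IsLocalRing.residue (Integers p) ⟨ζ, mem_integers.2 hζ.norm.le⟩ ∈ resField M := by
      apply mem_resField_of_pow
      rw [← map_pow]
      congr 1
      exact Subtype.ext h
    obtain ⟨x, hx, hxζ⟩ := h1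
    exact hζ.mem_of_isClosed (M := M.toSubfield) (isClosed_of_finiteDimensional M) hx
      (residue_eq.1 hxζ)

/-- A unit of `M` is congruent to a root of unity of order prime to `p` in `M`. -/
lemma exists_isTameRoot_mem (M : IntermediateField F ℂ_[p]) [FiniteDimensional F M] {x : ℂ_[p]}
    (hx : x ∈ M) (hx1 : ‖x‖ = 1) : ∃ ζ ∈ M, IsTameRoot ζ ∧ ‖x - ζ‖ < 1 := by
  obtain ⟨ζ, hζ, h⟩ := exists_isTameRoot hx1
  exact ⟨ζ, hζ.mem_of_isClosed (M := M.toSubfield) (isClosed_of_finiteDimensional M) hx h, hζ, h⟩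

lemma norm_algEquiv (M : IntermediateField F ℂ_[p]) [FiniteDimensional F M] (g : M ≃ₐ[F] M)
    (x : M) : ‖((g x : M) : ℂ_[p])‖ = ‖(x : ℂ_[p])‖ := by
  apply norm_eq_of_minpoly_eq (isIntegral_of_mem (g x).2) (isIntegral_of_mem x.2)
  have : IsScalarTower ℚ_[p] M ℂ_[p] :=
    IsScalarTower.of_algebraMap_eq fun a => by
      rw [IsScalarTower.algebraMap_apply ℚ_[p] F M, IsScalarTower.algebraMap_apply ℚ_[p] F ℂ_[p]]
      rfl
  have h1 := minpoly.algebraMap_eq (A := ℚ_[p]) (algebraMap M ℂ_[p]).injective (g x)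
  have h2 := minpoly.algebraMap_eq (A := ℚ_[p]) (algebraMap M ℂ_[p]).injective x
  have h3 := minpoly.algEquiv_eq (g.restrictScalars ℚ_[p]) x
  exact h1.trans (h3.trans h2.symm)

end Subfields

/-! ### Extensions generated by roots of unity of order prime to `p` -/

section TameExtensions

variable {p : ℕ} [Fact p.Prime] (F : Type*) [Field F] [Algebra F ℂ_[p]]

lemma IsTameRoot.isIntegral {ζ : ℂ_[p]} (hζ : IsTameRoot ζ) : IsIntegral F ζ := by
  obtain ⟨N, hN, h⟩ := hζ
  exact IsIntegral.of_pow (ne_zero_of_coprime hN).bot_lt (by rw [h]; exact isIntegral_one)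

lemma IsTameRoot.finiteDimensional {ζ : ℂ_[p]} (hζ : IsTameRoot ζ) :
    FiniteDimensional F (IntermediateField.adjoin F {ζ}) :=
  IntermediateField.adjoin.finiteDimensional (hζ.isIntegral F)

lemma IsTameRoot.isGalois {ζ : ℂ_[p]} (hζ : IsTameRoot ζ) :
    IsGalois F (IntermediateField.adjoin F {ζ}) := by
  have hpos : 0 < orderOf ζ := by
    obtain ⟨N, hN, h⟩ := hζ
    exact orderOf_pos_iff.2 (isOfFinOrder_iff_pow_eq_one.2 ⟨N, (ne_zero_of_coprime hN).bot_lt, h⟩)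
  have : NeZero (orderOf ζ) := ⟨hpos.ne'⟩
  have h := (IsPrimitiveRoot.orderOf ζ).adjoin_isCyclotomicExtension F
  have : IsCyclotomicExtension {orderOf ζ} F (IntermediateField.adjoin F {ζ}) := by
    change IsCyclotomicExtension _ F (IntermediateField.adjoin F {ζ}).toSubalgebra
    rw [IntermediateField.adjoin_simple_toSubalgebra_of_isAlgebraic
      (hζ.isIntegral F).isAlgebraic]
    exact h
  exact IsCyclotomicExtension.isGalois {orderOf ζ} F _

variable [Algebra ℚ_[p] F] [FiniteDimensional ℚ_[p] F] [IsScalarTower ℚ_[p] F ℂ_[p]]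

open Polynomial in
/-- Adjoining a root of unity of order prime to `p` gives an unramified extension. -/
lemma IsTameRoot.isUnramified {ζ : ℂ_[p]} (hζ : IsTameRoot ζ) :
    IsUnramified (IntermediateField.adjoin F {ζ}) := by
  classical
  intro x hx
  have := hζ.finiteDimensional F
  have := hζ.isGalois F
  set M := IntermediateField.adjoin F {ζ} with hM
  by_cases hx0 : x = 0
  · exact ⟨0, by simp [hx0]⟩
  have hζM : ζ ∈ M := IntermediateField.mem_adjoin_simple_self F ζ
  let z : M := ⟨ζ, hζM⟩
  let y : M := ⟨x, hx⟩
  have hg : ∀ g : M ≃ₐ[F] M, IsTameRoot ((g z : M) : ℂ_[p]) := by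
    intro g
    obtain ⟨N, hN, h⟩ := hζ
    refine ⟨N, hN, ?_⟩
    have : z ^ N = 1 := Subtype.ext h
    rw [← SubmonoidClass.coe_pow, ← map_pow, this, map_one]
    rfl
  -- The traces of `x ζ^j` lie in `F` and are bounded by `‖x‖`. It is enough that one of them
  -- attains this bound.
  let T : ℕ → M := fun j => ∑ g : M ≃ₐ[F] M, g (y * z ^ j)
  have hT : ∀ j, ∃ b : F, algebraMap F M b = T j := by
    intro j
    refine (IsGalois.mem_range_algebraMap_iff_fixed (T j)).2 fun f => ?_
    simp only [T, map_sum]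
    exact Fintype.sum_equiv (Equiv.mulLeft f) _ _ (fun g => rfl)
  have hle : ∀ j, ‖((T j : M) : ℂ_[p])‖ ≤ ‖x‖ := by
    intro j
    simp only [T]
    rw [AddSubmonoidClass.coe_finsetSum]
    apply IsUltrametricDist.norm_sum_le_of_forall_le_of_nonneg (norm_nonneg _)
    intro g _
    rw [norm_algEquiv]
    simp [y, z, hζ.norm]
  have hex : ∃ j, ‖((T j : M) : ℂ_[p])‖ = ‖x‖ := by
    by_contra! hne
    have hlt : ∀ j, ‖((T j : M) : ℂ_[p])‖ < ‖x‖ := fun j => lt_of_le_of_ne (hle j) (hne j)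
    -- `Q` is integral, vanishes at the conjugates of `ζ` other than `ζ`, and `‖Q(ζ)‖ = 1` because
    -- distinct tame roots are incongruent. Combining the traces with the coefficients of `Q`
    -- isolates `x Q(ζ)`, of norm `‖x‖`, so the traces cannot all be smaller.
    let Q : Polynomial ℂ_[p] := ∏ g ∈ Finset.univ.erase (1 : M ≃ₐ[F] M), (X - C ((g z : M) : ℂ_[p]))
    have hQ : Q ∈ lifts (Integers p).subtype :=
      prod_mem fun g _ => X_sub_C_mem_lifts (hg g).norm.le
    have hQg : ∀ g : M ≃ₐ[F] M, g ≠ 1 → Q.eval ((g z : M) : ℂ_[p]) = 0 := by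
      intro g hg1
      rw [eval_prod]
      exact Finset.prod_eq_zero (Finset.mem_erase.2 ⟨hg1, Finset.mem_univ _⟩) (by simp)
    have hQ1 : ‖Q.eval ζ‖ = 1 := by
      rw [eval_prod, norm_prod]
      refine Finset.prod_eq_one fun g hg1 => ?_
      have hgz : ((g z : M) : ℂ_[p]) ≠ ζ := by
        intro h
        refine (Finset.mem_erase.1 hg1).1 ?_
        have h2 : g.toAlgHom = (1 : M ≃ₐ[F] M).toAlgHom := by
          refine IntermediateField.algHom_ext_of_eq_adjoin F hM ?_
          rintro w hw
          obtain rfl := Set.mem_singleton_iff.1 hw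
          exact Subtype.ext h
        exact AlgEquiv.ext fun w => DFunLike.congr_fun h2 w
      rw [eval_sub, eval_X, eval_C]
      apply le_antisymm
      · exact (norm_sub_le_max' _ _).trans (max_le hζ.norm.le (hg g).norm.le)
      · by_contra! hlt
        exact hgz (hζ.eq_of_norm_sub_lt_one (hg g) hlt).symm
    have hsum : ∑ j ∈ Finset.range (Q.natDegree + 1), Q.coeff j * ((T j : M) : ℂ_[p]) =
        x * Q.eval ζ := by
      have h1 : ∀ j, ((T j : M) : ℂ_[p]) =
          ∑ g : M ≃ₐ[F] M, ((g y : M) : ℂ_[p]) * ((g z : M) : ℂ_[p]) ^ j := by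
        intro j
        simp [T]
      simp_rw [h1, Finset.mul_sum]
      rw [Finset.sum_comm]
      have h2 : ∀ g : M ≃ₐ[F] M, ∑ j ∈ Finset.range (Q.natDegree + 1),
          Q.coeff j * (((g y : M) : ℂ_[p]) * ((g z : M) : ℂ_[p]) ^ j) =
          ((g y : M) : ℂ_[p]) * Q.eval ((g z : M) : ℂ_[p]) := by
        intro g
        rw [eval_eq_sum_range, Finset.mul_sum]
        exact Finset.sum_congr rfl fun j _ => by ring
      simp_rw [h2]
      rw [Finset.sum_eq_single 1 (fun g _ hg1 => by rw [hQg g hg1, mul_zero]) (by simp)]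
      rfl
    have hlt2 : ‖∑ j ∈ Finset.range (Q.natDegree + 1), Q.coeff j * ((T j : M) : ℂ_[p])‖ < ‖x‖ := by
      obtain ⟨j, -, hj⟩ := IsUltrametricDist.exists_norm_finsetSum_le
        (Finset.range (Q.natDegree + 1)) (fun j => Q.coeff j * ((T j : M) : ℂ_[p]))
      refine hj.trans_lt ?_
      rw [norm_mul]
      exact (mul_le_of_le_one_left (norm_nonneg _) (norm_coeff_le_one_of_mem_lifts hQ j)).trans_lt
        (hlt j)
    rw [hsum, norm_mul, hQ1, mul_one] at hlt2
    exact lt_irrefl _ hlt2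
  obtain ⟨j, hj⟩ := hex
  obtain ⟨b, hb⟩ := hT j
  refine ⟨b, ?_⟩
  rw [← hj, ← hb]
  rfl

end TameExtensions

/-! ### The Frobenius automorphism -/

/-- When nonempty, this set is a coset of the stabilizer of `x`, which is open and hence closed. -/
lemma isClosed_setOf_apply_eq {p : ℕ} [Fact p.Prime] {F : Type*} [Field F] [Algebra ℚ_[p] F]
    [Algebra F (PadicAlgCl p)] [IsScalarTower ℚ_[p] F (PadicAlgCl p)] (x y : PadicAlgCl p) :
    IsClosed {g : PadicAlgCl p ≃ₐ[F] PadicAlgCl p | g x = y} := by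
  have : Algebra.IsAlgebraic F (PadicAlgCl p) := Algebra.IsAlgebraic.tower_top (K := ℚ_[p]) F
  rcases Set.eq_empty_or_nonempty {g : PadicAlgCl p ≃ₐ[F] PadicAlgCl p | g x = y} with h | ⟨g₀, h⟩
  · rw [h]; exact isClosed_empty
  have hopen := stabilizer_isOpen_of_isIntegral (K := F) x
  have hcl := Subgroup.isClosed_of_isOpen _ hopen
  have : {g : PadicAlgCl p ≃ₐ[F] PadicAlgCl p | g x = y} =
      (fun g => g₀⁻¹ * g) ⁻¹' (MulAction.stabilizer (PadicAlgCl p ≃ₐ[F] PadicAlgCl p) x : Set _) := by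
    ext g
    simp only [Set.mem_ofPred_eq, Set.mem_preimage, SetLike.mem_coe, MulAction.mem_stabilizer_iff]
    rw [mul_smul, inv_smul_eq_iff]
    change g x = y ↔ g x = g₀ x
    rw [show g₀ x = y from h]
  rw [this]
  exact hcl.preimage (continuous_const_mul _)

/-- Automorphisms of the algebraic closure extend to isometries of `ℂ_p`. -/
lemma exists_extension {p : ℕ} [Fact p.Prime] {F : Type*} [Field F] [Algebra ℚ_[p] F]
    [Algebra F ℂ_[p]] [Algebra F (PadicAlgCl p)] [IsScalarTower ℚ_[p] F (PadicAlgCl p)] (hF : ∀ a : F, algebraMap (PadicAlgCl p) ℂ_[p]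
    (algebraMap F (PadicAlgCl p) a) = algebraMap F ℂ_[p] a) (g : PadicAlgCl p ≃ₐ[F] PadicAlgCl p) :
    ∃ σ : ℂ_[p] ≃ₐ[F] ℂ_[p], (∀ x, ‖σ x‖ = ‖x‖) ∧
      ∀ b : PadicAlgCl p, σ (b : ℂ_[p]) = ((g b : PadicAlgCl p) : ℂ_[p]) := by
  have hiso : ∀ g : PadicAlgCl p ≃ₐ[F] PadicAlgCl p, Isometry g := by
    intro g
    refine AddMonoidHomClass.isometry_of_norm g fun x => ?_
    rw [← PadicAlgCl.spectralNorm_eq, ← PadicAlgCl.spectralNorm_eq]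
    exact (spectralNorm_eq_of_equiv (g.restrictScalars ℚ_[p]) x).symm
  have hg := (hiso g).continuous
  let e := UniformSpace.Completion.mapRingEquiv g.toRingEquiv hg (hiso g.symm).continuous
  have he : ∀ b : PadicAlgCl p, e (b : ℂ_[p]) = ((g b : PadicAlgCl p) : ℂ_[p]) :=
    fun b => UniformSpace.Completion.map_coe (hiso g).uniformContinuous b
  have hcomm : ∀ a : F, e (algebraMap F ℂ_[p] a) = algebraMap F ℂ_[p] a := by
    intro a
    rw [← hF, ← PadicComplex.coe_eq, he,
      AlgEquiv.commutes]
  refine ⟨AlgEquiv.ofRingEquiv (f := e) hcomm, fun x => ?_, he⟩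
  change ‖e x‖ = ‖x‖
  have hcont : Continuous e := UniformSpace.Completion.continuous_map
  refine UniformSpace.Completion.induction_on x
    (isClosed_eq hcont.norm continuous_norm) fun b => ?_
  rw [he, PadicComplex.norm_extends, PadicComplex.norm_extends]
  exact (AddMonoidHomClass.isometry_iff_norm g).1 (hiso g) b

section Frobenius

variable {p : ℕ} [Fact p.Prime] {F : Type*} [Field F] [Algebra ℚ_[p] F]
    [FiniteDimensional ℚ_[p] F] [Algebra F ℂ_[p]] [IsScalarTower ℚ_[p] F ℂ_[p]]

variable (p F) in
/-- The cardinality of the residue field of `F`. -/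
def baseCard : ℕ := resCard (⊥ : IntermediateField F ℂ_[p])

open Polynomial in
/-- The minimal polynomial of a root of unity `ζ` of order prime to `p` also vanishes at `ζ ^ q`. -/
lemma IsTameRoot.aeval_minpoly_pow {ζ : ℂ_[p]} (hζ : IsTameRoot ζ) :
    aeval (ζ ^ baseCard p F) (minpoly F ζ) = 0 := by
  obtain ⟨N, hN, hζN⟩ := id hζ
  have hint := hζ.isIntegral F
  obtain ⟨f, hf, hq⟩ := exists_resCard_eq_pow (⊥ : IntermediateField F ℂ_[p])
  set P := (minpoly F ζ).map (algebraMap F ℂ_[p]) with hP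
  have hPm : P.Monic := (minpoly.monic hint).map _
  have hroot : ∀ s ∈ P.roots, IsTameRoot s := by
    intro s hs
    refine ⟨N, hN, ?_⟩
    have hdvd : minpoly F ζ ∣ X ^ N - 1 := minpoly.dvd F ζ (by simp [hζN])
    have h1 : aeval s (minpoly F ζ) = 0 := by
      have := isRoot_of_mem_roots hs
      rwa [IsRoot.def, eval_map_algebraMap] at this
    have h2 := aeval_eq_zero_of_dvd_aeval_eq_zero hdvd h1
    simpa [sub_eq_zero] using h2
  have hlift : P ∈ lifts (Integers p).subtype := by
    rw [(IsAlgClosed.splits P).eq_prod_roots_of_monic hPm]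
    refine multiset_prod_mem _ fun Q hQ => ?_
    obtain ⟨s, hs, rfl⟩ := Multiset.mem_map.1 hQ
    exact X_sub_C_mem_lifts (hroot s hs).norm.le
  obtain ⟨R, hR⟩ := hlift
  replace hR : R.map (Integers p).subtype = P := hR
  set Rk := R.map (IsLocalRing.residue (Integers p)) with hRk
  -- The coefficients reduce into the residue field of `F`, where the `q`-power map is trivial.
  -- Hence the reduced polynomial takes the `q`-th power of its root to a root.
  have hfix : Rk.map (iterateFrobenius (Residue p) p f) = Rk := by
    ext i
    rw [coeff_map, iterateFrobenius_def, hRk, coeff_map, ← hq]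
    refine pow_resCard _ ⟨R.coeff i, ?_, rfl⟩
    have : ((R.coeff i : Integers p) : ℂ_[p]) = algebraMap F ℂ_[p] ((minpoly F ζ).coeff i) := by
      have := congrArg (fun S => S.coeff i) hR
      simpa [hP] using this
    change ((R.coeff i : Integers p) : ℂ_[p]) ∈ (⊥ : IntermediateField F ℂ_[p])
    rw [this]
    exact IntermediateField.algebraMap_mem _ _
  let z : Integers p := ⟨ζ, mem_integers.2 hζ.norm.le⟩
  have hz : R.eval z = 0 := by
    apply Subtype.ext
    have h1 : (R.map (Integers p).subtype).eval ((Integers p).subtype z) = 0 := by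
      rw [hR]
      change P.eval ζ = 0
      rw [hP, eval_map_algebraMap, minpoly.aeval]
    rw [eval_map, eval₂_at_apply] at h1
    exact h1
  have hzq : IsLocalRing.residue (Integers p) (R.eval (z ^ baseCard p F)) = 0 := by
    rw [← eval₂_at_apply, ← eval_map, ← hRk, map_pow, baseCard, hq, ← iterateFrobenius_def, ← hfix,
      eval_map, eval₂_at_apply, hRk, eval_map, eval₂_at_apply, hz, map_zero, map_zero]
  have hlt : ‖P.eval (ζ ^ baseCard p F)‖ < 1 := by
    rw [residue_eq_zero] at hzq
    have h1 : (R.map (Integers p).subtype).eval ((Integers p).subtype (z ^ baseCard p F)) =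
      ((R.eval (z ^ baseCard p F) : Integers p) : ℂ_[p]) := by
      rw [eval_map, eval₂_at_apply]; rfl
    rw [hR] at h1
    rw [← h1] at hzq
    exact hzq
  -- `ζ ^ q` is only known to be a root modulo the maximal ideal. A nearby exact root is a tame
  -- root, hence equal to `ζ ^ q`.
  obtain ⟨s, hs, hlt'⟩ := exists_root_norm_sub_lt_one hPm hlt
  rw [(hζ.pow _).eq_of_norm_sub_lt_one (hroot s hs) hlt']
  have := isRoot_of_mem_roots hs
  rwa [IsRoot.def, eval_map_algebraMap] at this

section Galois

variable [Algebra F (PadicAlgCl p)] [IsScalarTower ℚ_[p] F (PadicAlgCl p)]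

lemma exists_galois_eq_pow (hF : ∀ a : F, algebraMap (PadicAlgCl p) ℂ_[p]
    (algebraMap F (PadicAlgCl p) a) = algebraMap F ℂ_[p] a) {N : ℕ} (hN : p.Coprime N) :
    ∃ g : PadicAlgCl p ≃ₐ[F] PadicAlgCl p, ∀ ζ : PadicAlgCl p, ζ ^ N = 1 →
      g ζ = ζ ^ baseCard p F := by
  have : Algebra.IsAlgebraic F (PadicAlgCl p) := Algebra.IsAlgebraic.tower_top (K := ℚ_[p]) F
  have : IsAlgClosure F (PadicAlgCl p) := ⟨inferInstance, inferInstance⟩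
  have : Normal F (PadicAlgCl p) := IsAlgClosure.normal F _
  have : NeZero N := ⟨ne_zero_of_coprime hN⟩
  obtain ⟨ξ, hξ⟩ := HasEnoughRootsOfUnity.exists_primitiveRoot (PadicAlgCl p) N
  have htame : IsTameRoot (ξ : ℂ_[p]) :=
    ⟨N, hN, by rw [PadicComplex.coe_eq, ← map_pow, hξ.pow_eq_one, map_one]⟩
  have hinj := (algebraMap (PadicAlgCl p) ℂ_[p]).injective
  have h0 := htame.aeval_minpoly_pow (F := F)
  let j : PadicAlgCl p →ₐ[F] ℂ_[p] := { algebraMap (PadicAlgCl p) ℂ_[p] with commutes' := hF }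
  change Polynomial.aeval (j ξ ^ _) (minpoly F (j ξ)) = 0 at h0
  rw [minpoly.algHom_eq j hinj, ← map_pow, Polynomial.aeval_algHom_apply, map_eq_zero] at h0
  obtain ⟨g, hg⟩ := minpoly.exists_algEquiv_of_root
    (Algebra.IsAlgebraic.isAlgebraic (R := F) ξ) h0
  refine ⟨g.symm, fun ζ hζ => ?_⟩
  obtain ⟨i, -, rfl⟩ := hξ.eq_pow_of_pow_eq_one hζ
  rw [map_pow, ← hg, AlgEquiv.symm_apply_apply, ← pow_mul, hg, ← pow_mul, mul_comm]

/-- A compactness argument in the profinite Galois group: for each `N` the automorphisms with the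
required effect on `N`-th roots of unity form a nonempty closed set, and these sets are directed,
since the one for `N * M` lies in those for `N` and `M`. -/
lemma exists_galois_frobenius (hF : ∀ a : F, algebraMap (PadicAlgCl p) ℂ_[p]
    (algebraMap F (PadicAlgCl p) a) = algebraMap F ℂ_[p] a) :
    ∃ g : PadicAlgCl p ≃ₐ[F] PadicAlgCl p, ∀ (N : ℕ) (ζ : PadicAlgCl p), p.Coprime N → ζ ^ N = 1 →
      g ζ = ζ ^ baseCard p F := by
  have : Algebra.IsAlgebraic F (PadicAlgCl p) := Algebra.IsAlgebraic.tower_top (K := ℚ_[p]) F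
  have : IsAlgClosure F (PadicAlgCl p) := ⟨inferInstance, inferInstance⟩
  have : Normal F (PadicAlgCl p) := IsAlgClosure.normal F _
  have : CharZero F := charZero_of_injective_algebraMap (algebraMap ℚ_[p] F).injective
  have : IsGalois F (PadicAlgCl p) := ⟨⟩
  let S : {N : ℕ // p.Coprime N} → Set (PadicAlgCl p ≃ₐ[F] PadicAlgCl p) := fun N =>
    ⋂ (ζ : PadicAlgCl p) (_ : ζ ^ (N : ℕ) = 1), {g | g ζ = ζ ^ baseCard p F}
  have hcl : ∀ N, IsClosed (S N) := fun N =>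
    isClosed_iInter fun ζ => isClosed_iInter fun _ => isClosed_setOf_apply_eq _ _
  have : Nonempty {N : ℕ // p.Coprime N} := ⟨⟨1, by simp⟩⟩
  have hne := IsCompact.nonempty_iInter_of_directed_nonempty_isCompact_isClosed S
    (fun N M => ⟨⟨N * M, Nat.Coprime.mul_right N.2 M.2⟩, by
      intro g hg
      simp only [S, Set.mem_iInter] at hg ⊢
      exact fun ζ hζ => hg ζ (by rw [pow_mul, hζ, one_pow]), by
      intro g hg
      simp only [S, Set.mem_iInter] at hg ⊢
      exact fun ζ hζ => hg ζ (by rw [mul_comm, pow_mul, hζ, one_pow])⟩)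
    (fun N => by
      obtain ⟨g, hg⟩ := exists_galois_eq_pow hF N.2
      exact ⟨g, by simp only [S, Set.mem_iInter]; exact hg⟩)
    (fun N => (hcl N).isCompact) hcl
  obtain ⟨g, hg⟩ := hne
  refine ⟨g, fun N ζ hN hζ => ?_⟩
  simp only [S, Set.mem_iInter] at hg
  exact hg ⟨N, hN⟩ ζ hζ

end Galois

variable (p F) in
/-- The Frobenius automorphism, extended to `ℂ_p`. -/
lemma exists_frobenius : ∃ σ : ℂ_[p] ≃ₐ[F] ℂ_[p], (∀ x, ‖σ x‖ = ‖x‖) ∧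
    ∀ ζ : ℂ_[p], IsTameRoot ζ → σ ζ = ζ ^ baseCard p F := by
  have hF : ∀ a : F, ∃ b : PadicAlgCl p, (b : ℂ_[p]) = algebraMap F ℂ_[p] a := fun a =>
    exists_coe_of_isIntegral ((IsIntegral.of_finite ℚ_[p] a).algebraMap)
  have hinj := (algebraMap (PadicAlgCl p) ℂ_[p]).injective
  let R := (IsScalarTower.toAlgHom ℚ_[p] (PadicAlgCl p) ℂ_[p]).range
  let e := AlgEquiv.ofInjective (IsScalarTower.toAlgHom ℚ_[p] (PadicAlgCl p) ℂ_[p]) hinj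
  -- `F` is finite over `ℚ_p`, so its image in `ℂ_p` consists of algebraic elements and factors
  -- through `PadicAlgCl p`.
  let ι : F →ₐ[ℚ_[p]] PadicAlgCl p := e.symm.toAlgHom.comp
    ((IsScalarTower.toAlgHom ℚ_[p] F ℂ_[p]).codRestrict R fun a => hF a)
  have hι : ∀ a : F, algebraMap (PadicAlgCl p) ℂ_[p] (ι a) = algebraMap F ℂ_[p] a := fun a =>
    congrArg Subtype.val (e.apply_symm_apply
      ((IsScalarTower.toAlgHom ℚ_[p] F ℂ_[p]).codRestrict R (fun a => hF a) a))
  let _ : Algebra F (PadicAlgCl p) := ι.toRingHom.toAlgebra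
  have : IsScalarTower ℚ_[p] F (PadicAlgCl p) :=
    IsScalarTower.of_algebraMap_eq fun a => (ι.commutes a).symm
  obtain ⟨g, hg⟩ := exists_galois_frobenius (p := p) (F := F) hι
  obtain ⟨σ, hσ, hσg⟩ := exists_extension hι g
  refine ⟨σ, hσ, fun ζ hζ => ?_⟩
  obtain ⟨b, rfl⟩ := exists_coe_of_isIntegral (hζ.isIntegral ℚ_[p])
  obtain ⟨N, hN, hN1⟩ := hζ
  rw [hσg, hg N b hN (hinj (by rw [map_pow, map_one]; exact hN1)), PadicComplex.coe_eq, map_pow]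
  rfl

end Frobenius

/-! ### The maximal unramified extension and its completion -/

section FrobeniusPowers

variable {p : ℕ} [Fact p.Prime] {F : Type*} [Field F] [Algebra F ℂ_[p]]

/-- An isometric automorphism of `ℂ_p` that acts on roots of unity of order prime to `p`, and hence
on the residue field, as `x ↦ x ^ Q`. -/
structure IsFrobeniusPower (τ : ℂ_[p] ≃ₐ[F] ℂ_[p]) (Q : ℕ) : Prop where
  norm : ∀ x, ‖τ x‖ = ‖x‖
  apply_tame : ∀ ζ, IsTameRoot ζ → τ ζ = ζ ^ Q

lemma IsFrobeniusPower.pow {τ : ℂ_[p] ≃ₐ[F] ℂ_[p]} {Q : ℕ} (h : IsFrobeniusPower τ Q) (n : ℕ) :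
    IsFrobeniusPower (τ ^ n) (Q ^ n) := by
  induction n with
  | zero => exact ⟨fun x => by simp, fun ζ _ => by simp⟩
  | succ n ih =>
    refine ⟨fun x => ?_, fun ζ hζ => ?_⟩
    · rw [pow_succ, AlgEquiv.mul_apply, ih.norm, h.norm]
    · rw [pow_succ, AlgEquiv.mul_apply, h.apply_tame ζ hζ, map_pow, ih.apply_tame ζ hζ, pow_succ,
        pow_mul]

/-- A unit may be replaced by the tame root congruent to it, where the action of `τ` is prescribed,
and a nonunit has both terms small. -/
lemma IsFrobeniusPower.norm_sub_lt_one {τ : ℂ_[p] ≃ₐ[F] ℂ_[p]} {Q : ℕ} (h : IsFrobeniusPower τ Q)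
    (hQ : Q ≠ 0) {a : ℂ_[p]} (ha : ‖a‖ ≤ 1) : ‖τ a - a ^ Q‖ < 1 := by
  rcases ha.lt_or_eq with ha' | ha'
  · refine (norm_sub_le_max' _ _).trans_lt (max_lt (by rwa [h.norm]) ?_)
    rw [norm_pow]
    exact pow_lt_one₀ (norm_nonneg _) ha' hQ
  · obtain ⟨ζ, hζ, hlt⟩ := exists_isTameRoot ha'
    refine norm_sub_lt_trans (y := τ ζ) (by rwa [← map_sub, h.norm]) ?_
    rw [h.apply_tame ζ hζ]
    exact norm_pow_sub_pow_lt_one hζ.norm.le ha (by rwa [norm_sub_rev]) Q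

end FrobeniusPowers

section Unramified

variable {p : ℕ} [Fact p.Prime] {F : Type*} [Field F] [Algebra F ℂ_[p]]

lemma exists_isPrimitiveRoot {N : ℕ} (hN : p.Coprime N) : ∃ ζ : ℂ_[p], IsPrimitiveRoot ζ N := by
  have : NeZero N := ⟨ne_zero_of_coprime hN⟩
  exact HasEnoughRootsOfUnity.exists_primitiveRoot ℂ_[p] N

lemma isClosed_completedUnramified : IsClosed (completedUnramified p F : Set ℂ_[p]) :=
  isClosed_closure (s := (maxUnramified p F : Set ℂ_[p]))

lemma le_maxUnramified (K : IntermediateField F ℂ_[p]) [hK : FiniteDimensional F K]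
    (h : IsUnramified K) : K ≤ maxUnramified p F :=
  le_iSup₂_of_le (f := fun (K : IntermediateField F ℂ_[p])
      (_ : FiniteDimensional F K ∧ IsUnramified K) => K) K ⟨hK, h⟩ le_rfl

lemma isUnramified_bot : IsUnramified (⊥ : IntermediateField F ℂ_[p]) := by
  intro x hx
  obtain ⟨y, rfl⟩ := IntermediateField.mem_bot.1 hx
  exact ⟨y, rfl⟩

lemma IsTameRoot.map {ζ : ℂ_[p]} (hζ : IsTameRoot ζ) (τ : ℂ_[p] ≃ₐ[F] ℂ_[p]) :
    IsTameRoot (τ ζ) := by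
  obtain ⟨N, hN, h⟩ := hζ
  exact ⟨N, hN, by rw [← map_pow, h, map_one]⟩

/-- An element of the extension generated by all roots of unity of order prime to `p` already lies
in the extension generated by one of them. -/
lemma exists_mem_adjoin_tame {x : ℂ_[p]}
    (hx : x ∈ IntermediateField.adjoin F {ζ : ℂ_[p] | IsTameRoot ζ}) :
    ∃ ζ, IsTameRoot ζ ∧ x ∈ IntermediateField.adjoin F {ζ} := by
  classical
  obtain ⟨T, hT, hxT⟩ := IntermediateField.exists_finset_of_mem_adjoin hx
  have hN : ∃ N : ℕ, p.Coprime N ∧ ∀ t ∈ T, t ^ N = 1 := by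
    clear hxT
    induction T using Finset.induction_on with
    | empty => exact ⟨1, by simp, by simp⟩
    | insert a T _ ih =>
      obtain ⟨N, hN, h⟩ := ih fun t ht => hT (Finset.mem_insert_of_mem ht)
      obtain ⟨M, hM, hM'⟩ := hT (Finset.mem_insert_self a T)
      refine ⟨N * M, Nat.Coprime.mul_right hN hM, fun t ht => ?_⟩
      rcases Finset.mem_insert.1 ht with rfl | ht
      · rw [mul_comm, pow_mul, hM', one_pow]
      · rw [pow_mul, h t ht, one_pow]
  obtain ⟨N, hN, h⟩ := hN
  have : NeZero N := ⟨ne_zero_of_coprime hN⟩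
  -- All the roots of unity in `T` have order dividing `N`, so they are powers of one primitive
  -- `N`-th root.
  obtain ⟨ζ, hζ⟩ := exists_isPrimitiveRoot hN
  refine ⟨ζ, ⟨N, hN, hζ.pow_eq_one⟩, ?_⟩
  refine IntermediateField.adjoin_le_iff.2 ?_ hxT
  intro t ht
  obtain ⟨i, -, rfl⟩ := hζ.eq_pow_of_pow_eq_one (h t ht)
  exact pow_mem (IntermediateField.mem_adjoin_simple_self F ζ) i

variable [Algebra ℚ_[p] F] [FiniteDimensional ℚ_[p] F] [IsScalarTower ℚ_[p] F ℂ_[p]]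

lemma coprime_resCard_sub_one (M : IntermediateField F ℂ_[p]) [FiniteDimensional F M] :
    p.Coprime (resCard M - 1) := by
  obtain ⟨f, hf, h⟩ := exists_resCard_eq_pow M
  have h1 := one_lt_resCard M
  have h2 : p ∣ (resCard M - 1) + 1 := by
    rw [Nat.sub_add_cancel h1.le, h]
    exact dvd_pow_self p hf
  exact Nat.Coprime.coprime_dvd_left h2 (by simp)

/-- A finite unramified extension is generated by a root of unity. -/
lemma IsUnramified.exists_eq_adjoin {M : IntermediateField F ℂ_[p]} [FiniteDimensional F M]
    (hM : IsUnramified M) : ∃ ζ : ℂ_[p], IsTameRoot ζ ∧ IsPrimitiveRoot ζ (resCard M - 1) ∧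
      M = IntermediateField.adjoin F {ζ} := by
  have hcop := coprime_resCard_sub_one M
  have h1 := one_lt_resCard M
  have : NeZero (resCard M - 1) := ⟨ne_zero_of_coprime hcop⟩
  obtain ⟨ζ, hζ⟩ := exists_isPrimitiveRoot hcop
  have htame : IsTameRoot ζ := ⟨_, hcop, hζ.pow_eq_one⟩
  have hpow : ∀ ξ : ℂ_[p], ξ ≠ 0 → (ξ ^ resCard M = ξ ↔ ξ ^ (resCard M - 1) = 1) := by
    intro ξ hξ
    conv_lhs => rw [← Nat.sub_add_cancel h1.le, pow_succ]
    exact mul_eq_right₀ hξ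
  have hζM : ζ ∈ M := (htame.mem_iff M).2 ((hpow ζ htame.ne_zero).2 hζ.pow_eq_one)
  refine ⟨ζ, htame, hζ, le_antisymm ?_ ?_⟩
  · have := htame.finiteDimensional F
    have hle : IntermediateField.adjoin F {ζ} ≤ M := by
      rw [IntermediateField.adjoin_le_iff]
      exact Set.singleton_subset_iff.2 hζM
    intro x hx
    -- The value groups agree because `M` is unramified, and each unit residue of `M` is represented
    -- by a power of `ζ`, so approximation over `F(ζ)` never fails.
    refine mem_of_approx _ ?_ ?_
    · intro y hy
      obtain ⟨b, hb⟩ := hM _ (sub_mem hx (hle hy))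
      exact ⟨_, IntermediateField.algebraMap_mem _ b, hb⟩
    · intro y hy c hc hn
      obtain ⟨ξ, hξM, hξ, hlt⟩ := exists_isTameRoot_mem M
        (mul_mem (hle hc) (sub_mem hx (hle hy))) hn
      refine ⟨ξ, ?_, hlt⟩
      obtain ⟨i, -, rfl⟩ := hζ.eq_pow_of_pow_eq_one
        ((hpow ξ hξ.ne_zero).1 ((hξ.mem_iff M).1 hξM))
      exact pow_mem (IntermediateField.mem_adjoin_simple_self F ζ) i
  · rw [IntermediateField.adjoin_le_iff]
    exact Set.singleton_subset_iff.2 hζM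

lemma IsUnramified.isGalois {M : IntermediateField F ℂ_[p]} [FiniteDimensional F M]
    (hM : IsUnramified M) : IsGalois F M := by
  obtain ⟨ζ, hζ, -, h⟩ := hM.exists_eq_adjoin
  rw [h]
  exact hζ.isGalois F

lemma IsTameRoot.mem_maxUnramified {ζ : ℂ_[p]} (hζ : IsTameRoot ζ) : ζ ∈ maxUnramified p F := by
  have := hζ.finiteDimensional F
  exact le_maxUnramified _ (hζ.isUnramified F) (IntermediateField.mem_adjoin_simple_self F ζ)

lemma maxUnramified_eq :
    maxUnramified p F = IntermediateField.adjoin F {ζ : ℂ_[p] | IsTameRoot ζ} := by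
  apply le_antisymm
  · refine iSup₂_le fun M hM => ?_
    have := hM.1
    obtain ⟨ζ, hζ, -, h⟩ := hM.2.exists_eq_adjoin
    rw [h]
    exact IntermediateField.adjoin.mono _ _ _ (Set.singleton_subset_iff.2 hζ)
  · rw [IntermediateField.adjoin_le_iff]
    exact fun ζ hζ => IsTameRoot.mem_maxUnramified hζ

lemma IsTameRoot.mem_completedUnramified {ζ : ℂ_[p]} (hζ : IsTameRoot ζ) :
    ζ ∈ completedUnramified p F :=
  subset_closure (IsTameRoot.mem_maxUnramified (F := F) hζ)

/-- `L` has the same value group as `F`. -/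
lemma exists_norm_eq {x : ℂ_[p]} (hx : x ∈ completedUnramified p F) :
    ∃ b : F, ‖x‖ = ‖algebraMap F ℂ_[p] b‖ := by
  by_cases hx0 : x = 0
  · exact ⟨0, by simp [hx0]⟩
  obtain ⟨y, hy, hxy⟩ := Metric.mem_closure_iff.1 hx ‖x‖ (norm_pos_iff.2 hx0)
  rw [dist_eq_norm] at hxy
  have hy' : y ∈ maxUnramified p F := hy
  rw [maxUnramified_eq] at hy'
  obtain ⟨ζ, hζ, hyζ⟩ := exists_mem_adjoin_tame hy'
  obtain ⟨b, hb⟩ := hζ.isUnramified F y hyζ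
  exact ⟨b, by rw [← hb, norm_eq_of_norm_sub_lt hxy]⟩

/-- An automorphism permutes the tame roots, which generate `F^un`, and an isometry preserves the
closure. -/
lemma map_mem_completedUnramified {τ : ℂ_[p] ≃ₐ[F] ℂ_[p]} (hτ : ∀ x, ‖τ x‖ = ‖x‖) {x : ℂ_[p]}
    (hx : x ∈ completedUnramified p F) : τ x ∈ completedUnramified p F := by
  have hcont : Continuous τ := (AddMonoidHomClass.isometry_of_norm τ hτ).continuous
  refine map_mem_closure hcont hx fun y hy => ?_
  have hle : (IntermediateField.adjoin F {ζ : ℂ_[p] | IsTameRoot ζ}) ≤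
      (IntermediateField.adjoin F {ζ : ℂ_[p] | IsTameRoot ζ}).comap τ.toAlgHom := by
    rw [IntermediateField.adjoin_le_iff]
    exact fun ζ hζ => IntermediateField.subset_adjoin F _ (IsTameRoot.map hζ τ)
  have hy' : y ∈ maxUnramified p F := hy
  change τ y ∈ maxUnramified p F
  rw [maxUnramified_eq] at hy' ⊢
  exact hle hy'

variable {σ : ℂ_[p] ≃ₐ[F] ℂ_[p]}

lemma IsUnramified.apply_eq_self {M : IntermediateField F ℂ_[p]} [FiniteDimensional F M]
    (hM : IsUnramified M) {Q : ℕ} {τ : ℂ_[p] ≃ₐ[F] ℂ_[p]} (hτ : IsFrobeniusPower τ Q)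
    (hQ : ∀ ζ ∈ M, IsTameRoot ζ → ζ ^ Q = ζ) {x : ℂ_[p]} (hx : x ∈ M) : τ x = x := by
  obtain ⟨ζ, hζ, -, h⟩ := hM.exists_eq_adjoin
  have hζM : ζ ∈ M := h ▸ IntermediateField.mem_adjoin_simple_self F ζ
  have hhom : τ.toAlgHom.comp M.val = M.val := by
    refine IntermediateField.algHom_ext_of_eq_adjoin F h ?_
    rintro y hy
    obtain rfl := Set.mem_singleton_iff.1 hy
    exact (hτ.apply_tame _ hζ).trans (hQ _ hζM hζ)
  exact DFunLike.congr_fun hhom ⟨x, hx⟩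

/-- The elements of `L` fixed by the automorphism inducing `x ↦ x ^ #k_M` on the residue field lie
in the unramified extension `M`. -/
lemma IsUnramified.mem_of_fixed {M : IntermediateField F ℂ_[p]} [FiniteDimensional F M]
    (hM : IsUnramified M) {τ : ℂ_[p] ≃ₐ[F] ℂ_[p]} (hτ : IsFrobeniusPower τ (resCard M)) {x : ℂ_[p]}
    (hx : x ∈ completedUnramified p F) (hfix : τ x = x) : x ∈ M := by
  have hMfix : ∀ y ∈ M, τ y = y := fun y hy =>
    hM.apply_eq_self hτ (fun ζ hζM hζ => (hζ.mem_iff M).1 hζM) hy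
  have hle := le_completedUnramified M hM
  refine mem_of_approx M ?_ ?_
  · intro y hy
    obtain ⟨b, hb⟩ := exists_norm_eq (sub_mem hx (hle hy))
    exact ⟨_, IntermediateField.algebraMap_mem _ b, hb⟩
  · intro y hy c hc hn
    obtain ⟨ζ, hζ, hlt⟩ := exists_isTameRoot hn
    refine ⟨ζ, (hζ.mem_iff M).2 ?_, hlt⟩
    rw [← hτ.apply_tame ζ hζ]
    -- Both `ζ` and `τ ζ` are congruent to the fixed element `c * (x - y)`, so they coincide.
    refine (hζ.map τ).eq_of_norm_sub_lt_one hζ (norm_sub_lt_trans (y := c * (x - y)) ?_ hlt)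
    have : τ (c * (x - y)) = c * (x - y) := by
      rw [map_mul, map_sub, hMfix c hc, hMfix y hy, hfix]
    rw [← this, ← map_sub, hτ.norm, norm_sub_rev]
    exact hlt

lemma mem_range_of_fixed (hσ : IsFrobeniusPower σ (baseCard p F)) {x : ℂ_[p]}
    (hx : x ∈ completedUnramified p F) (hfix : σ x = x) : ∃ b : F, algebraMap F ℂ_[p] b = x :=
  IntermediateField.mem_bot.1 (isUnramified_bot.mem_of_fixed hσ hx hfix)

lemma baseCard_pos : 1 < baseCard p F := one_lt_resCard _

/-- The Frobenius automorphism generates the Galois group of an unramified extension of degree `r`,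
and the residue field of this extension has `q ^ r` elements. -/
lemma IsUnramified.frobenius_generates {M : IntermediateField F ℂ_[p]} [FiniteDimensional F M]
    [IsGalois F M] (hM : IsUnramified M) (hσ : IsFrobeniusPower σ (baseCard p F)) :
    (∀ g : M ≃ₐ[F] M, g ∈ Subgroup.zpowers (σ.restrictNormal M)) ∧
      resCard M = baseCard p F ^ Module.finrank F M := by
  set s' := σ.restrictNormal M with hs'
  have hcomm : ∀ (j : ℕ) (x : M), (((s' ^ j) x : M) : ℂ_[p]) = (σ ^ j) (x : ℂ_[p]) := by
    intro j
    induction j with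
    | zero => intro x; simp
    | succ j ih =>
      intro x
      rw [pow_succ, AlgEquiv.mul_apply, ih, pow_succ, AlgEquiv.mul_apply]
      congr 1
      exact AlgEquiv.restrictNormal_commutes σ M x
  -- Only elements of `F` are fixed by `σ`, so Galois theory makes `s'` a generator and its order
  -- the degree.
  have hfixed : IntermediateField.fixedField (Subgroup.zpowers s') = ⊥ := by
    rw [eq_bot_iff]
    intro x hx
    have h1 : s' x = x := hx ⟨s', Subgroup.mem_zpowers s'⟩
    have h2 : σ (x : ℂ_[p]) = x := by
      have := hcomm 1 x
      rw [pow_one, pow_one, h1] at this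
      exact this.symm
    obtain ⟨b, hb⟩ := mem_range_of_fixed hσ (le_completedUnramified M hM x.2) h2
    exact IntermediateField.mem_bot.2 ⟨b, Subtype.ext hb⟩
  have hcard : Nat.card (Subgroup.zpowers s') = Module.finrank F M := by
    rw [← IntermediateField.finrank_fixedField_eq_card, hfixed]
    exact IntermediateField.finrank_bot'
  have htop : Subgroup.zpowers s' = ⊤ := by
    apply Subgroup.eq_top_of_card_eq
    rw [hcard, IsGalois.card_aut_eq_finrank]
  refine ⟨fun g => htop ▸ Subgroup.mem_top g, ?_⟩
  rw [Nat.card_zpowers] at hcard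
  obtain ⟨s, hs0, hs⟩ := resCard_pow_of_le (bot_le : (⊥ : IntermediateField F ℂ_[p]) ≤ M)
  change resCard M = baseCard p F ^ s at hs
  obtain ⟨ζ, hζ, hprim, h⟩ := hM.exists_eq_adjoin
  have hζM : ζ ∈ M := h ▸ IntermediateField.mem_adjoin_simple_self F ζ
  have hq := baseCard_pos (p := p) (F := F)
  -- `σ ^ s` fixes the tame roots of `M`, hence `M`, so the order of `s'` divides the residue degree
  -- `s`.
  have h1 : Module.finrank F M ∣ s := by
    rw [← hcard]
    apply orderOf_dvd_of_pow_eq_one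
    ext x
    rw [hcomm]
    exact hM.apply_eq_self (hσ.pow s)
      (fun ζ hζM hζ => by rw [← hs]; exact (hζ.mem_iff M).1 hζM) x.2
  -- Conversely `σ ^ [M : F]` fixes a primitive root of unity of order `q ^ s - 1`, so `q ^ s - 1`
  -- divides `q ^ [M : F] - 1`.
  have h2 : s ≤ Module.finrank F M := by
    have h3 : ζ ^ (baseCard p F ^ Module.finrank F M) = ζ := by
      rw [← (hσ.pow _).apply_tame ζ hζ, ← hcard]
      have := hcomm (orderOf s') ⟨ζ, hζM⟩
      rw [pow_orderOf_eq_one] at this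
      exact this.symm
    have hqr : 1 < baseCard p F ^ Module.finrank F M := Nat.one_lt_pow Module.finrank_pos.ne' hq
    have h4 : ζ ^ (baseCard p F ^ Module.finrank F M - 1) = 1 := by
      rw [← Nat.sub_add_cancel hqr.le, pow_succ] at h3
      exact (mul_eq_right₀ hζ.ne_zero).1 h3
    have h5 := Nat.le_of_dvd (by omega) (hprim.dvd_of_pow_eq_one _ h4)
    have h6 := one_lt_resCard M
    rw [hs] at h5 h6
    exact (Nat.pow_le_pow_iff_right hq).1 (by omega)
  rw [hs, le_antisymm h2 (Nat.le_of_dvd hs0.bot_lt h1)]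

end Unramified

/-! ### Surjectivity of `φ - 1` on units -/

section Lang

variable {p : ℕ} [Fact p.Prime]

/-- In a complete subgroup of `ℂ_p`, an additive map that can be inverted up to a contraction can be
inverted. -/
lemma exists_preimage_of_approx {S : AddSubgroup ℂ_[p]} (hS : IsClosed (S : Set ℂ_[p]))
    {f : ℂ_[p] →+ ℂ_[p]} (hf : Continuous f) {c : ℝ} (hc0 : 0 ≤ c) (hc : c < 1)
    (h : ∀ e ∈ S, ∃ x ∈ S, ‖x‖ ≤ ‖e‖ ∧ f x - e ∈ S ∧ ‖f x - e‖ ≤ c * ‖e‖) {e : ℂ_[p]} (he : e ∈ S) :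
    ∃ x ∈ S, ‖x‖ ≤ ‖e‖ ∧ f x = e := by
  choose! g hgS hg1 hgS' hg2 using h
  -- `R n` is the error left after `n` corrections. The solution is the sum of the corrections `g (R
  -- n)`, and the ultrametric inequality bounds it by `‖e‖`.
  let R : ℕ → ℂ_[p] := fun n => Nat.rec e (fun _ y => y - f (g y)) n
  have hR : ∀ n, R (n + 1) = R n - f (g (R n)) := fun n => rfl
  have hRS : ∀ n, R n ∈ S := by
    intro n
    induction n with
    | zero => exact he
    | succ n ih =>
      rw [hR, ← neg_sub]
      exact neg_mem (hgS' _ ih)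
  have hRn : ∀ n, ‖R n‖ ≤ c ^ n * ‖e‖ := by
    intro n
    induction n with
    | zero => simp [R]
    | succ n ih =>
      rw [hR, norm_sub_rev, pow_succ', mul_assoc]
      exact (hg2 _ (hRS n)).trans (mul_le_mul_of_nonneg_left ih hc0)
  have hsum : Summable fun n => g (R n) := by
    refine Summable.of_norm_bounded (g := fun n => c ^ n * ‖e‖)
      ((summable_geometric_of_lt_one hc0 hc).mul_right _) fun n => ?_
    exact (hg1 _ (hRS n)).trans (hRn n)
  have hpart : ∀ n, ∑ i ∈ Finset.range n, f (g (R i)) = e - R n := by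
    intro n
    induction n with
    | zero => simp [R]
    | succ n ih => rw [Finset.sum_range_succ, ih, hR]; ring
  have hR0 : Filter.Tendsto R Filter.atTop (nhds 0) := by
    refine squeeze_zero_norm hRn ?_
    simpa using (tendsto_pow_atTop_nhds_zero_of_lt_one hc0 hc).mul_const ‖e‖
  have hx := hsum.hasSum.tendsto_sum_nat
  refine ⟨∑' n, g (R n), ?_, ?_, ?_⟩
  · exact hS.mem_of_tendsto hx (Filter.Eventually.of_forall fun n =>
      sum_mem fun i _ => hgS _ (hRS i))
  · refine le_of_tendsto hx.norm (Filter.Eventually.of_forall fun n => ?_)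
    refine IsUltrametricDist.norm_sum_le_of_forall_le_of_nonneg (norm_nonneg _) fun i _ => ?_
    exact ((hg1 _ (hRS i)).trans (hRn i)).trans
      (mul_le_of_le_one_left (norm_nonneg _) (pow_le_one₀ hc0 hc.le))
  · have h1 := (hf.tendsto _).comp hx
    have h2 : Filter.Tendsto (fun n => e - R n) Filter.atTop (nhds (e - 0)) :=
      tendsto_const_nhds.sub hR0
    rw [sub_zero] at h2
    refine tendsto_nhds_unique h1 (h2.congr fun n => ?_)
    rw [← hpart, Function.comp_apply, map_sum]

open Polynomial in
-- The leading coefficient is a unit, so at a point of norm greater than one the term `w a ^ Q`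
-- would dominate the others. This equation is the reduction of `φ x - u x = e` after scaling by
-- `e`.
lemma exists_root_integral {w u : ℂ_[p]} (hw : ‖w‖ = 1) (hu : ‖u‖ = 1) {Q : ℕ} (hQ : 1 < Q) :
    ∃ a : ℂ_[p], ‖a‖ ≤ 1 ∧ w * a ^ Q - u * a = 1 := by
  have hw0 : w ≠ 0 := norm_ne_zero_iff.1 (by rw [hw]; exact one_ne_zero)
  have hdeg : (C w * X ^ Q - (C u * X + C 1)).degree = (Q : WithBot ℕ) := by
    rw [degree_sub_eq_left_of_degree_lt, degree_C_mul_X_pow _ hw0]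
    rw [degree_C_mul_X_pow _ hw0]
    exact (degree_linear_le).trans_lt (by exact_mod_cast hQ)
  obtain ⟨a, ha⟩ := IsAlgClosed.exists_root (C w * X ^ Q - (C u * X + C 1)) (by
    rw [hdeg]
    exact_mod_cast (by omega : Q ≠ 0))
  have ha' : w * a ^ Q - (u * a + 1) = 0 := by simpa [IsRoot.def] using ha
  refine ⟨a, ?_, by linear_combination ha'⟩
  by_contra! hlt
  have h1 : ‖w * a ^ Q‖ ≤ ‖a‖ := by
    rw [sub_eq_zero.1 ha']
    refine (IsUltrametricDist.norm_add_le_max _ _).trans (max_le ?_ ?_)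
    · rw [norm_mul, hu, one_mul]
    · rw [norm_one]; exact hlt.le
  rw [norm_mul, norm_pow, hw, one_mul] at h1
  have h2 : ‖a‖ ^ 1 < ‖a‖ ^ Q := pow_lt_pow_right₀ hlt hQ
  rw [pow_one] at h2
  exact absurd h1 (not_le.2 h2)

lemma exists_approx_mem {S : Subfield ℂ_[p]} (htame : ∀ ζ, IsTameRoot ζ → ζ ∈ S) {a : ℂ_[p]}
    (ha : ‖a‖ ≤ 1) : ∃ b ∈ S, ‖b‖ ≤ 1 ∧ ‖a - b‖ < 1 := by
  rcases ha.lt_or_eq with ha' | ha'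
  · exact ⟨0, zero_mem _, by simp, by simpa using ha'⟩
  · obtain ⟨ζ, hζ, h⟩ := exists_isTameRoot ha'
    exact ⟨ζ, htame ζ hζ, hζ.norm.le, h⟩

variable {F : Type*} [Field F] [Algebra F ℂ_[p]]

/-- In a complete discretely valued subfield of `ℂ_p` with residue field `𝔽̄_p`, every unit is of the
form `φ x / x`, where `φ` induces a power of Frobenius on the residue field. -/
lemma IsFrobeniusPower.exists_apply_eq_mul {φ : ℂ_[p] ≃ₐ[F] ℂ_[p]} {Q : ℕ}
    (hφ : IsFrobeniusPower φ Q) (hQ : 1 < Q) {S : Subfield ℂ_[p]}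
    (hS : IsClosed (S : Set ℂ_[p])) (hφS : ∀ x ∈ S, φ x ∈ S)
    (htame : ∀ ζ, IsTameRoot ζ → ζ ∈ S) {c : ℝ} (hc0 : 0 ≤ c) (hc : c < 1)
    (hdisc : ∀ x ∈ S, ‖x‖ < 1 → ‖x‖ ≤ c) {u : ℂ_[p]} (hu : u ∈ S) (hu1 : ‖u‖ = 1) :
    ∃ x ∈ S, ‖x‖ = 1 ∧ φ x = u * x := by
  have hQ0 : Q ≠ 0 := by omega
  have hφc : Continuous φ := (AddMonoidHomClass.isometry_of_norm φ hφ.norm).continuous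
  have hu0 : u ≠ 0 := norm_ne_zero_iff.1 (by rw [hu1]; exact one_ne_zero)
  let f : ℂ_[p] →+ ℂ_[p] := (φ : ℂ_[p] →+ ℂ_[p]) - AddMonoidHom.mulLeft u
  have hf : ∀ x, f x = φ x - u * x := fun x => rfl
  have hfc : Continuous f := hφc.sub (continuous_const.mul continuous_id)
  have hfS : ∀ x ∈ S, f x ∈ S := fun x hx => sub_mem (hφS x hx) (mul_mem hu hx)
  -- The additive map `φ - u` is surjective, with control of norms. For `x = e * b` the equation
  -- becomes `w b^Q - u b ≡ 1` with `w = φ(e)/e`; an element of `S` congruent to a root solves it up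
  -- to the factor `c`, which discreteness makes uniform.
  have hsurj : ∀ e ∈ S, ∃ x ∈ S, ‖x‖ ≤ ‖e‖ ∧ f x = e := by
    intro e he
    refine exists_preimage_of_approx (S := S.toSubring.toAddSubgroup) hS hfc hc0 hc ?_ he
    intro e he
    by_cases he0 : e = 0
    · refine ⟨0, zero_mem _, by simp, ?_, ?_⟩
      · rw [map_zero, he0, sub_zero]; exact zero_mem _
      · simp [he0]
    have hφe : φ e / e ∈ S := div_mem (hφS e he) he
    have hw : ‖φ e / e‖ = 1 := by
      rw [norm_div, hφ.norm, div_self (norm_ne_zero_iff.2 he0)]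
    obtain ⟨a, ha, hroot⟩ := exists_root_integral hw hu1 hQ
    obtain ⟨b, hbS, hb1, hab⟩ := exists_approx_mem htame ha
    have hfe : f (e * b) - e = e * (φ e / e * φ b - u * b - 1) := by
      rw [hf, map_mul]; field_simp
    have hlt : ‖φ e / e * φ b - u * b - 1‖ < 1 := by
      have h1 : φ e / e * φ b - u * b - 1 = φ e / e * (φ b - a ^ Q) + u * (a - b) := by
        linear_combination hroot
      rw [h1]
      refine (IsUltrametricDist.norm_add_le_max _ _).trans_lt (max_lt ?_ ?_)
      · rw [norm_mul, hw, one_mul]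
        refine norm_sub_lt_trans (hφ.norm_sub_lt_one hQ0 hb1) ?_
        exact norm_pow_sub_pow_lt_one hb1 ha (by rwa [norm_sub_rev]) Q
      · rwa [norm_mul, hu1, one_mul]
    have hmem : φ e / e * φ b - u * b - 1 ∈ S :=
      sub_mem (sub_mem (mul_mem hφe (hφS b hbS)) (mul_mem hu hbS)) (one_mem S)
    refine ⟨e * b, mul_mem (s := S) he hbS, ?_, ?_, ?_⟩
    · rw [norm_mul]; exact mul_le_of_le_one_right (norm_nonneg _) hb1
    · exact sub_mem (H := S) (hfS _ (mul_mem he hbS)) he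
    · rw [hfe, norm_mul, mul_comm]
      exact mul_le_mul_of_nonneg_right (hdisc _ hmem hlt) (norm_nonneg _)
  -- A root of `y ^ (Q - 1) = u` gives a unit `x` with `φ x ≡ u x`. Subtracting a small `z` with the
  -- same image under `f` makes the equation exact and leaves a unit.
  obtain ⟨y, hy⟩ := IsAlgClosed.exists_pow_nat_eq u (n := Q - 1) (by omega)
  have hy1 : ‖y‖ = 1 := by
    have := congrArg (‖·‖) hy
    simp only [norm_pow, hu1] at this
    exact (pow_eq_one_iff_of_nonneg (norm_nonneg _) (by omega)).1 this
  obtain ⟨x, hx, hyx⟩ := exists_isTameRoot hy1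
  have hfx : ‖f x‖ < 1 := by
    rw [hf]
    refine norm_sub_lt_trans (hφ.norm_sub_lt_one hQ0 hx.norm.le) ?_
    refine norm_sub_lt_trans (norm_pow_sub_pow_lt_one hx.norm.le hy1.le
      (by rwa [norm_sub_rev]) Q) ?_
    rw [← Nat.sub_add_cancel hQ.le, pow_succ, hy, ← mul_sub, norm_mul, hu1, one_mul]
    exact hyx
  obtain ⟨z, hzS, hz, hfz⟩ := hsurj (f x) (hfS x (htame x hx))
  refine ⟨x - z, sub_mem (htame x hx) hzS, ?_, ?_⟩
  · have h1 : ‖x - (x - z)‖ < ‖x‖ := by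
      rw [sub_sub_cancel, hx.norm]
      exact hz.trans_lt hfx
    rw [norm_eq_of_norm_sub_lt h1, hx.norm]
  · have h1 : f (x - z) = 0 := by rw [map_sub, hfz, sub_self]
    rwa [hf, sub_eq_zero] at h1

end Lang

/-! ### The compositum `K L`: completeness and automorphisms -/

section Compositum

variable {p : ℕ} [Fact p.Prime] {F : Type*} [Field F] [Algebra F ℂ_[p]]

lemma map_mem_of_normal (K : IntermediateField F ℂ_[p]) [Normal F K] (τ : ℂ_[p] ≃ₐ[F] ℂ_[p])
    {x : ℂ_[p]} (hx : x ∈ K) : τ x ∈ K := by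
  have h := AlgEquiv.restrictNormal_commutes τ K ⟨x, hx⟩
  change _ = τ x at h
  rw [← h]
  exact (τ.restrictNormal K ⟨x, hx⟩).2

lemma exists_pow_apply_eq_self (K : IntermediateField F ℂ_[p]) [FiniteDimensional F K] [Normal F K]
    (τ : ℂ_[p] ≃ₐ[F] ℂ_[p]) : ∃ m : ℕ, m ≠ 0 ∧ ∀ x ∈ K, (τ ^ m) x = x := by
  refine ⟨Nat.card (K ≃ₐ[F] K), Nat.card_pos.ne', fun x hx => ?_⟩
  have h1 : AlgEquiv.restrictNormalHom K (τ ^ Nat.card (K ≃ₐ[F] K)) = 1 := by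
    rw [map_pow, pow_card_eq_one']
  have h2 := AlgEquiv.restrictNormal_commutes (τ ^ Nat.card (K ≃ₐ[F] K)) K ⟨x, hx⟩
  rw [show (τ ^ Nat.card (K ≃ₐ[F] K)).restrictNormal K = 1 from h1] at h2
  exact h2.symm

lemma algebraMap_mem_compositum (K : IntermediateField F ℂ_[p]) {x : ℂ_[p]}
    (hx : x ∈ completedUnramified p F) : x ∈ compositum K :=
  (compositum K).algebraMap_mem ⟨x, hx⟩

variable (p F) in
/-- The normed field structure of `L`, inherited from `ℂ_p`. -/
abbrev completedUnramifiedNormedField : NontriviallyNormedField (completedUnramified p F) where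
  __ := SubfieldClass.toNormedField (completedUnramified p F)
  non_trivial := by
    have hp : (p : ℂ_[p]) ≠ 0 := Nat.cast_ne_zero.2 (Fact.out : p.Prime).ne_zero
    refine ⟨((p : completedUnramified p F))⁻¹, ?_⟩
    change 1 < ‖((p : ℂ_[p]))⁻¹‖
    rw [norm_inv]
    exact (one_lt_inv₀ (norm_pos_iff.2 hp)).2 norm_natCast_p_lt_one

/-- `K L` is finite-dimensional over the complete field `L`. -/
lemma isClosed_compositum (K : IntermediateField F ℂ_[p]) [FiniteDimensional F K] :
    IsClosed (compositum K : Set ℂ_[p]) := by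
  let _ := completedUnramifiedNormedField p F
  have : CompleteSpace (completedUnramified p F) :=
    (isClosed_completedUnramified (p := p) (F := F)).completeSpace_coe
  have : ContinuousSMul (completedUnramified p F) ℂ_[p] :=
    ⟨(continuous_subtype_val.comp continuous_fst).mul continuous_snd⟩
  have : FiniteDimensional (completedUnramified p F)
      (Subalgebra.toSubmodule (compositum K).toSubalgebra) :=
    inferInstanceAs (FiniteDimensional (completedUnramified p F) (compositum K))
  exact (Subalgebra.toSubmodule (compositum K).toSubalgebra).closed_of_finiteDimensional

/-- Automorphisms of a finite extension of the complete field `L` are isometric. -/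
lemma norm_galois_compositum (K : IntermediateField F ℂ_[p]) [FiniteDimensional F K]
    (g : compositum K ≃ₐ[completedUnramified p F] compositum K) (x : compositum K) :
    ‖((g x : compositum K) : ℂ_[p])‖ = ‖(x : ℂ_[p])‖ := by
  let _ := completedUnramifiedNormedField p F
  have : CompleteSpace (completedUnramified p F) :=
    (isClosed_completedUnramified (p := p) (F := F)).completeSpace_coe
  let _ : NormedSpace (completedUnramified p F) (compositum K) :=
    { norm_smul_le := fun a y => (norm_mul (a : ℂ_[p]) (y : ℂ_[p])).le }
  have hle : ∀ (g : compositum K ≃ₐ[completedUnramified p F] compositum K) (x : compositum K),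
      ‖((g x : compositum K) : ℂ_[p])‖ ≤ ‖(x : ℂ_[p])‖ := by
    intro g x
    let f := LinearMap.toContinuousLinearMap g.toLinearMap
    -- The automorphism is a bounded linear map. Applying the bound to all powers of `x` removes the
    -- operator norm, since an exponentially growing ratio cannot be bounded.
    have hf : ∀ n : ℕ, ‖((g x : compositum K) : ℂ_[p])‖ ^ n ≤ ‖f‖ * ‖(x : ℂ_[p])‖ ^ n := by
      intro n
      have h1 : ‖f (x ^ n)‖ ≤ ‖f‖ * ‖x ^ n‖ := f.le_opNorm (x ^ n)
      have h2 : ‖f (x ^ n)‖ = ‖((g x : compositum K) : ℂ_[p])‖ ^ n := by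
        change ‖((g (x ^ n) : compositum K) : ℂ_[p])‖ = _
        rw [map_pow, SubmonoidClass.coe_pow, norm_pow]
      have h3 : ‖x ^ n‖ = ‖(x : ℂ_[p])‖ ^ n := by
        change ‖((x ^ n : compositum K) : ℂ_[p])‖ = _
        rw [SubmonoidClass.coe_pow, norm_pow]
      rwa [h2, h3] at h1
    by_contra! hlt
    by_cases hx0 : x = 0
    · simp [hx0] at hlt
    have hx : 0 < ‖(x : ℂ_[p])‖ := norm_pos_iff.2 fun h => hx0 (Subtype.ext h)
    have hone : 1 < ‖((g x : compositum K) : ℂ_[p])‖ / ‖(x : ℂ_[p])‖ := (one_lt_div hx).2 hlt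
    obtain ⟨n, hn⟩ := pow_unbounded_of_one_lt ‖f‖ hone
    rw [div_pow, lt_div_iff₀ (pow_pos hx n)] at hn
    exact absurd (hf n) (not_le.2 hn)
  refine le_antisymm (hle g x) ?_
  have := hle g.symm (g x)
  rwa [AlgEquiv.symm_apply_apply] at this

-- If `K` is the splitting field over `F` of a separable polynomial, then `K L` is the splitting
-- field of the same polynomial over `L`.
open Polynomial in
instance (K : IntermediateField F ℂ_[p]) [FiniteDimensional F K] [IsGalois F K] :
    IsGalois (completedUnramified p F) (compositum K) := by
  obtain ⟨T, hT₁, hT₂⟩ := IsGalois.is_separable_splitting_field F K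
  rw [isSplittingField_iff_intermediateField] at hT₂
  obtain ⟨hs, hadj⟩ := hT₂
  rw [← IntermediateField.lift_inj, IntermediateField.lift_adjoin, ← IntermediateField.coe_val,
    hs.image_rootSet, IntermediateField.lift_top] at hadj
  let T' := T.map (algebraMap F (completedUnramified p F))
  have hroot : T'.rootSet ℂ_[p] = T.rootSet ℂ_[p] := by
    simp [Set.ext_iff, Polynomial.mem_rootSet', T']
  have hE : compositum K = IntermediateField.adjoin (completedUnramified p F)
      (T'.rootSet ℂ_[p]) := by
    apply le_antisymm
    · rw [IntermediateField.adjoin_le_iff]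
      have hle : K ≤ (IntermediateField.adjoin (completedUnramified p F)
          (T'.rootSet ℂ_[p])).restrictScalars F := by
        rw [← hadj, IntermediateField.adjoin_le_iff, hroot]
        exact IntermediateField.subset_adjoin _ _
      exact fun x hx => hle hx
    · refine IntermediateField.adjoin.mono _ _ _ ?_
      rw [hroot]
      conv_rhs => rw [← hadj]
      exact IntermediateField.subset_adjoin _ _
  have : T'.IsSplittingField (completedUnramified p F) (compositum K) := by
    rw [hE]
    exact IntermediateField.adjoin_rootSet_isSplittingField (IsAlgClosed.splits _)
  exact IsGalois.of_separable_splitting_field (p := T') hT₁.map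

variable [Algebra ℚ_[p] F] [FiniteDimensional ℚ_[p] F] [IsScalarTower ℚ_[p] F ℂ_[p]]

lemma map_mem_compositum (K : IntermediateField F ℂ_[p]) [Normal F K] {τ : ℂ_[p] ≃ₐ[F] ℂ_[p]}
    (hτ : ∀ x, ‖τ x‖ = ‖x‖) {x : ℂ_[p]} (hx : x ∈ compositum K) : τ x ∈ compositum K := by
  induction hx using IntermediateField.adjoin_induction with
  | mem x hx => exact IntermediateField.subset_adjoin _ _ (map_mem_of_normal K τ hx)
  | algebraMap x =>
    exact algebraMap_mem_compositum K (map_mem_completedUnramified hτ x.2)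
  | add x y _ _ hx hy => rw [map_add]; exact add_mem hx hy
  | inv x _ hx => rw [map_inv₀]; exact inv_mem hx
  | mul x y _ _ hx hy => rw [map_mul]; exact mul_mem hx hy

end Compositum

/-! ### Points of tori over fields -/

section PointsFunctoriality

variable {F : Type*} [Field F] {A : Type*} [CommRing A] [HopfAlgebra F A]
  {R S : Type*} [CommRing R] [Algebra F R] [CommRing S] [Algebra F S]

lemma Points.ext {s t : Points F A R} (h : ∀ a, s.ofConv a = t.ofConv a) : s = t :=
  WithConv.ofConv_injective (AlgHom.ext h)

variable [Coalgebra.IsCocomm F A]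

@[simp]
lemma Points.map_apply (f : R →ₐ[F] S) (t : Points F A R) (a : A) :
    (Points.map f t).ofConv a = f (t.ofConv a) := rfl

lemma Points.map_injective {f : R →ₐ[F] S} (hf : Function.Injective f) :
    Function.Injective (Points.map (A := A) f) := fun _ _ h =>
  Points.ext fun a => hf (congrArg (fun t : Points F A S => t.ofConv a) h)

lemma Points.exists_map_eq {f : R →ₐ[F] S} (hf : Function.Injective f) {t : Points F A S}
    (ht : ∀ a, ∃ x, f x = t.ofConv a) : ∃ y : Points F A R, Points.map f y = t := by
  let e := AlgEquiv.ofInjective f hf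
  let g : A →ₐ[F] f.range := t.ofConv.codRestrict f.range fun a => ht a
  refine ⟨WithConv.toConv (e.symm.toAlgHom.comp g), Points.ext fun a => ?_⟩
  exact congrArg Subtype.val (e.apply_symm_apply (g a))

end PointsFunctoriality

/-! ### Points of a split torus as homomorphisms from the character group -/

section SplitTori

variable {F : Type*} [Field F] {A : Type*} [CommRing A] [HopfAlgebra F A]
  {K E : Type*} [Field K] [Algebra F K] [Field E] [Algebra F E]

lemma isGroupLikeElem_map_algHom (g : K →ₐ[F] E) {x : K ⊗[F] A} (hx : IsGroupLikeElem K x) :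
    IsGroupLikeElem E (Algebra.TensorProduct.map g (AlgHom.id F A) x) := by
  set τ := Algebra.TensorProduct.map g (AlgHom.id F A) with hτ
  have hsmul : ∀ (e : K) (y : K ⊗[F] A), τ (e • y) = g e • τ y := by
    intro e y
    induction y with
    | zero => simp
    | add y z hy hz => simp only [smul_add, map_add, hy, hz]
    | tmul e' a => simp [hτ, TensorProduct.smul_tmul']
  let τₗ : K ⊗[F] A →ₛₗ[(g : K →+* E)] E ⊗[F] A :=
    { toFun := τ, map_add' := map_add τ, map_smul' := hsmul }
  have hcounit : ∀ y : K ⊗[F] A,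
      Coalgebra.counit (R := E) (τ y) = g (Coalgebra.counit (R := K) y) := by
    intro y
    induction y with
    | zero => simp
    | add y z hy hz => simp only [map_add, hy, hz]
    | tmul e' a => simp [hτ]
  have hcomul : ∀ y : K ⊗[F] A, Coalgebra.comul (R := E) (τ y) =
      TensorProduct.map τₗ τₗ (Coalgebra.comul (R := K) y) := by
    intro y
    induction y with
    | zero => simp
    | add y z hy hz => simp only [map_add, hy, hz]
    | tmul e' a =>
      simp [hτ, τₗ, ← (Coalgebra.Repr.arbitrary F a).eq, TensorProduct.tmul_sum]
  exact ⟨by rw [hcounit, hx.counit_eq_one, map_one], by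
    rw [hcomul, hx.comul_eq_tmul_self, TensorProduct.map_tmul]; rfl⟩

variable (A) in
lemma map_tensor_injective (j : K →ₐ[F] E) :
    Function.Injective (Algebra.TensorProduct.map j (AlgHom.id F A)) := by
  have := Module.Flat.rTensor_preserves_injective_linearMap (M := A) j.toLinearMap j.injective
  exact this

/-- If `T` splits over `K`, then over any extension `E` of `K` the characters of `T` form a free
abelian group, span the coordinate ring, and are defined over `K`. -/
lemma exists_char_equiv (j : K →ₐ[F] E) (hK : IsSplitOver F A K) :
    ∃ (n : ℕ) (ψ : K ⊗[F] A ≃ₐ[K] AddMonoidAlgebra K (Fin n → ℤ))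
      (c : Multiplicative (Fin n → ℤ) ≃* Char F A E),
      (∀ v, (c v).val = Algebra.TensorProduct.map j (AlgHom.id F A)
        (ψ.symm (AddMonoidAlgebra.single v.toAdd 1))) ∧
      Submodule.span E (Set.range (GroupLike.val (R := E) (A := E ⊗[F] A))) = ⊤ := by
  obtain ⟨n, ⟨ψ₀⟩⟩ := hK
  let ψ : K ⊗[F] A ≃ₐ[K] AddMonoidAlgebra K (Fin n → ℤ) := AlgEquivClass.toAlgEquiv ψ₀
  set jA := Algebra.TensorProduct.map j (AlgHom.id F A) with hjA
  let u : Multiplicative (Fin n → ℤ) → K ⊗[F] A := fun v =>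
    ψ.symm (AddMonoidAlgebra.single v.toAdd 1)
  have hu : ∀ v, IsGroupLikeElem K (u v) := fun v =>
    (AddMonoidAlgebra.isGroupLikeElem_single_one (R := K) (A := K) v.toAdd).map ψ₀.symm
  have humul : ∀ v w, u (v * w) = u v * u w := by
    intro v w
    simp only [u]
    rw [← map_mul, AddMonoidAlgebra.single_mul_single, one_mul]
    rfl
  let c₀ : Multiplicative (Fin n → ℤ) →* Char F A E := MonoidHom.mk'
    (fun v => ⟨jA (u v), isGroupLikeElem_map_algHom j (hu v)⟩) (by
      intro v w
      apply GroupLike.val_injective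
      simp [humul])
  have hspan : Submodule.span E (Set.range fun v => (c₀ v).val) = ⊤ := by
    rw [eq_top_iff]
    rintro x -
    have hmem : ∀ y : K ⊗[F] A, jA y ∈ Submodule.span E (Set.range fun v => (c₀ v).val) := by
      intro y
      obtain ⟨z, rfl⟩ : ∃ z, ψ.symm z = y := ψ.symm.surjective y
      induction z using AddMonoidAlgebra.induction_linear with
      | zero => simp
      | add f g hf hg => rw [map_add, map_add]; exact add_mem hf hg
      | single v k =>
        have h1 : (AddMonoidAlgebra.single v k : AddMonoidAlgebra K (Fin n → ℤ)) =
          algebraMap K _ k * AddMonoidAlgebra.single v 1 := by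
          simp
        have h2 : jA (ψ.symm (AddMonoidAlgebra.single v k)) =
            j k • (c₀ (Multiplicative.ofAdd v)).val := by
          rw [h1, map_mul, AlgEquiv.commutes, map_mul, Algebra.smul_def]
          congr 1
        rw [h2]
        exact Submodule.smul_mem _ _ (Submodule.subset_span ⟨_, rfl⟩)
    induction x with
    | zero => exact zero_mem _
    | add x y hx hy => exact add_mem hx hy
    | tmul e a =>
      have : e ⊗ₜ[F] a = e • jA (1 ⊗ₜ a) := by
        simp [hjA, TensorProduct.smul_tmul']
      rw [this]
      exact Submodule.smul_mem _ _ (hmem _)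
  have hinj : Function.Injective c₀ := by
    intro v w h
    have h1 : jA (u v) = jA (u w) := congrArg GroupLike.val h
    have h2 := ψ.symm.injective (map_tensor_injective A j h1)
    exact (AddMonoidAlgebra.single_left_injective one_ne_zero) h2
  -- Distinct group-like elements are linearly independent, and those coming from `ℤⁿ` already span,
  -- so there is no room for another.
  have hsurj : Function.Surjective c₀ := by
    intro χ
    by_contra! hχ
    have hli : LinearIndepOn E id (insert χ.val (Set.range fun v => (c₀ v).val)) :=
      linearIndepOn_isGroupLikeElem.mono (by
        rintro _ (rfl | ⟨v, rfl⟩)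
        · exact χ.2
        · exact (c₀ v).2)
    have hnot : χ.val ∉ Submodule.span E (id '' (Set.range fun v => (c₀ v).val)) :=
      hli.notMem_span_of_insert (by
        rintro ⟨v, hv⟩
        exact hχ v (GroupLike.val_injective hv))
    rw [Set.image_id, hspan] at hnot
    exact hnot Submodule.mem_top
  refine ⟨n, ψ, MulEquiv.ofBijective c₀ ⟨hinj, hsurj⟩, fun v => rfl, ?_⟩
  rw [eq_top_iff, ← hspan]
  exact Submodule.span_mono (by rintro _ ⟨v, rfl⟩; exact ⟨c₀ v, rfl⟩)

lemma galChar_galChar_symm (g : E ≃ₐ[F] E) (χ : Char F A E) :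
    galChar g (galChar g.symm χ) = χ := by
  apply GroupLike.val_injective
  change Algebra.TensorProduct.map g.toAlgHom (AlgHom.id F A)
    (Algebra.TensorProduct.map g.symm.toAlgHom (AlgHom.id F A) χ.val) = χ.val
  generalize χ.val = x
  induction x with
  | zero => simp
  | add x y hx hy => simp only [map_add, hx, hy]
  | tmul k a => simp

/-- Homomorphisms from the character group lift along surjections of abelian groups. -/
lemma exists_char_lift (j : K →ₐ[F] E) (hK : IsSplitOver F A K) {U V : Type*} [CommGroup U]
    [CommGroup V] {δ : U →* V} (hδ : Function.Surjective δ) (a : Char F A E →* V) :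
    ∃ h : Char F A E →* U, δ.comp h = a := by
  obtain ⟨n, -, c, -, -⟩ := exists_char_equiv (A := A) j hK
  let δ' : Additive U →ₗ[ℤ] Additive V := (MonoidHom.toAdditive δ).toIntLinearMap
  let a' : (Fin n → ℤ) →ₗ[ℤ] Additive V :=
    (MonoidHom.toAdditiveRight (a.comp c.toMonoidHom)).toIntLinearMap
  obtain ⟨h, hh⟩ := Module.projective_lifting_property δ' a' hδ
  refine ⟨(AddMonoidHom.toMultiplicativeLeft h.toAddMonoidHom).comp c.symm.toMonoidHom, ?_⟩
  ext1 χ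
  have := DFunLike.congr_fun hh (c.symm χ).toAdd
  refine (show _ = _ from this).trans ?_
  change a (c (c.symm χ)) = a χ
  rw [MulEquiv.apply_symm_apply]

/-- All characters are defined over the splitting field `K`, which `φ` fixes. -/
lemma galChar_eq_self (j : K →ₐ[F] E) (hK : IsSplitOver F A K) {φ : E ≃ₐ[F] E}
    (hφ : ∀ x, φ (j x) = j x) (χ : Char F A E) : galChar φ χ = χ := by
  obtain ⟨n, ψ, c, hc, -⟩ := exists_char_equiv (A := A) j hK
  obtain ⟨v, rfl⟩ := c.surjective χ
  apply GroupLike.val_injective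
  change Algebra.TensorProduct.map φ.toAlgHom (AlgHom.id F A) (c v).val = (c v).val
  rw [hc]
  generalize ψ.symm (AddMonoidAlgebra.single v.toAdd 1) = x
  induction x with
  | zero => simp
  | add x y hx hy => simp only [map_add, hx, hy]
  | tmul k a => simp [hφ]

variable [Coalgebra.IsCocomm F A]

lemma evalAlgHom_map (t : Points F A K) (g : K →ₐ[F] E) (x : K ⊗[F] A) :
    evalAlgHom (Points.map g t) (Algebra.TensorProduct.map g (AlgHom.id F A) x) =
      g (evalAlgHom t x) := by
  induction x with
  | zero => simp
  | add x y hx hy => simp only [map_add, hx, hy]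
  | tmul k a => simp [evalAlgHom]

lemma evalChar_map_galChar (g : E ≃ₐ[F] E) (t : Points F A E) (χ : Char F A E) :
    evalChar (Points.map g.toAlgHom t) (galChar g χ) =
      Units.map (g : E →* E) (evalChar t χ) :=
  Units.ext (evalAlgHom_map t g.toAlgHom χ.val)

lemma galCochar_ordPoint (g : E ≃ₐ[F] E) {ord : Eˣ →* Multiplicative ℤ}
    (hord : ∀ x, ord (Units.map (g : E →* E) x) = ord x) (t : Points F A E) :
    galCochar g (ordPoint ord t) = ordPoint ord (Points.map g.toAlgHom t) := by
  ext1 χ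
  change ord (evalChar t (galChar g.symm χ)) = ord (evalChar (Points.map g.toAlgHom t) χ)
  conv_rhs => rw [← galChar_galChar_symm g χ, evalChar_map_galChar, hord]

lemma ordPoint_eq_one_iff {ord : Eˣ →* Multiplicative ℤ} {t : Points F A E} :
    ordPoint ord t = 1 ↔ ∀ χ, evalChar t χ ∈ ord.ker :=
  MonoidHom.ext_iff

lemma ordPoint_map_eq_one (g : E ≃ₐ[F] E) {ord : Eˣ →* Multiplicative ℤ}
    (hord : ∀ x, ord (Units.map (g : E →* E) x) = ord x) {t : Points F A E}
    (ht : ordPoint ord t = 1) : ordPoint ord (Points.map g.toAlgHom t) = 1 := by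
  rw [← galCochar_ordPoint g hord, ht]
  rfl

/-- The characters span the coordinate ring over `E`. Together with `evalChar_surjective` this
identifies `T(E)` with `Hom(X^*(T), E^×)`. -/
lemma evalChar_injective (j : K →ₐ[F] E) (hK : IsSplitOver F A K) :
    Function.Injective (evalChar (F := F) (A := A) (E := E)) := by
  obtain ⟨n, ψ, c, -, hspan⟩ := exists_char_equiv (A := A) j hK
  intro s t h
  have h1 : (evalAlgHom s).toLinearMap = (evalAlgHom t).toLinearMap := by
    refine LinearMap.ext_on_range hspan fun χ => ?_
    exact congrArg (fun f : Char F A E →* Eˣ => ((f χ : Eˣ) : E)) h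
  refine Points.ext fun a => ?_
  have h2 := DFunLike.congr_fun h1 (1 ⊗ₜ[F] a)
  simpa [evalAlgHom] using h2

/-- A homomorphism from `ℤⁿ` to `E^×` extends to the group algebra over `K`, which is the coordinate
ring of `T_K`. -/
lemma evalChar_surjective (j : K →ₐ[F] E) (hK : IsSplitOver F A K) :
    Function.Surjective (evalChar (F := F) (A := A) (E := E)) := by
  obtain ⟨n, ψ, c, hc, -⟩ := exists_char_equiv (A := A) j hK
  intro f
  let _ : Algebra K E := j.toRingHom.toAlgebra
  have : IsScalarTower F K E := IsScalarTower.of_algebraMap_eq fun x => (j.commutes x).symm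
  let Φ : AddMonoidAlgebra K (Fin n → ℤ) →ₐ[K] E :=
    AddMonoidAlgebra.lift K E (Fin n → ℤ) ((Units.coeHom E).comp (f.comp c.toMonoidHom))
  let Ψ : K ⊗[F] A →ₐ[K] E := Φ.comp ψ.toAlgHom
  let t : Points F A E := WithConv.toConv
    ((Ψ.restrictScalars F).comp Algebra.TensorProduct.includeRight)
  have ht : ∀ y, evalAlgHom t (Algebra.TensorProduct.map j (AlgHom.id F A) y) = Ψ y := by
    intro y
    induction y with
    | zero => simp
    | add x y hx hy => simp only [map_add, hx, hy]
    | tmul k a =>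
      have h1 : k ⊗ₜ[F] a = k • (1 ⊗ₜ[F] a : K ⊗[F] A) := by simp [TensorProduct.smul_tmul']
      have h2 : Ψ (k ⊗ₜ[F] a) = j k * Ψ (1 ⊗ₜ[F] a) := by
        rw [h1, map_smul, Algebra.smul_def]
        rfl
      rw [h2]
      simp only [evalAlgHom, Algebra.TensorProduct.map_tmul, Algebra.TensorProduct.lift_tmul]
      rfl
  refine ⟨t, MonoidHom.ext fun χ => ?_⟩
  obtain ⟨v, rfl⟩ := c.surjective χ
  apply Units.ext
  change evalAlgHom t (c v).val = _
  rw [hc, ht]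
  change Φ (ψ (ψ.symm _)) = _
  rw [AlgEquiv.apply_symm_apply]
  simp [Φ, AddMonoidAlgebra.lift_single]

lemma ordPoint_surjective (j : K →ₐ[F] E) (hK : IsSplitOver F A K)
    {ord : Eˣ →* Multiplicative ℤ} (hord : Function.Surjective ord) :
    Function.Surjective (ordPoint (F := F) (A := A) ord) := by
  intro x
  obtain ⟨h, hh⟩ := exists_char_lift j hK hord x
  obtain ⟨t, ht⟩ := evalChar_surjective j hK h
  refine ⟨t, ?_⟩
  change ord.comp (evalChar t) = x
  rw [ht, hh]

/-- If `φ` fixes the splitting field `K` and `φ - 1` is surjective on the units of `E`, then it is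
surjective on the points of `T` with values in the units. -/
lemma exists_map_eq_mul_of_fixes (j : K →ₐ[F] E) (hK : IsSplitOver F A K) {φ : E ≃ₐ[F] E}
    (hφ : ∀ x, φ (j x) = j x) {ord : Eˣ →* Multiplicative ℤ}
    (hord : ∀ x, ord (Units.map (φ : E →* E) x) = ord x)
    (hsurj : ∀ u ∈ ord.ker, ∃ x ∈ ord.ker, Units.map (φ : E →* E) x = u * x)
    {t : Points F A E} (ht : ordPoint ord t = 1) :
    ∃ s : Points F A E, ordPoint ord s = 1 ∧ Points.map φ.toAlgHom s = t * s := by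
  let φU : ord.ker →* ord.ker := ((Units.map (φ : E →* E)).comp ord.ker.subtype).codRestrict _
    fun x => by
      rw [MonoidHom.mem_ker, MonoidHom.comp_apply, hord]
      exact x.2
  let δ : ord.ker →* ord.ker := φU / MonoidHom.id _
  have hδ : Function.Surjective δ := by
    rintro ⟨u, hu⟩
    obtain ⟨x, hx, h⟩ := hsurj u hu
    refine ⟨⟨x, hx⟩, ?_⟩
    apply Subtype.ext
    change Units.map (φ : E →* E) x / x = u
    rw [h, mul_div_cancel_right]
  -- Integral points are homomorphisms from the free group `X^*(T)` to the units, so they lift along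
  -- the surjection `δ = φ - 1`.
  obtain ⟨h, hh⟩ := exists_char_lift j hK hδ
    ((evalChar t).codRestrict ord.ker (ordPoint_eq_one_iff.1 ht))
  obtain ⟨s, hs⟩ := evalChar_surjective j hK (ord.ker.subtype.comp h)
  have hs' : ∀ χ, evalChar s χ = (h χ : Eˣ) := fun χ => DFunLike.congr_fun hs χ
  refine ⟨s, ordPoint_eq_one_iff.2 fun χ => ?_, evalChar_injective j hK ?_⟩
  · rw [hs']
    exact (h χ).2
  · ext1 χ
    have h1 : (φU (h χ) / h χ : ord.ker) = _ := DFunLike.congr_fun hh χ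
    have h2 : Units.map (φ : E →* E) (h χ : Eˣ) / (h χ : Eˣ) = evalChar t χ :=
      congrArg Subtype.val h1
    conv_lhs => rw [← galChar_eq_self j hK hφ χ, evalChar_map_galChar, hs']
    rw [map_mul, MonoidHom.mul_apply, hs', ← h2, div_mul_cancel]

end SplitTori

/-! ### The kernel of the Kottwitz homomorphism -/

section Kernel

variable {F : Type*} [Field F] {A : Type*} [CommRing A] [HopfAlgebra F A] [Coalgebra.IsCocomm F A]
  {E : Type*} [Field E] [Algebra F E] {L : Type*} [Field L] [Algebra F L] [Algebra L E]
  [IsScalarTower F L E] [FiniteDimensional L E]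

lemma normPoint_apply (t : Points F A E) :
    normPoint F A E L t = ∏ g : E ≃ₐ[L] E, Points.map (g.restrictScalars F).toAlgHom t := by
  rw [normPoint, MonoidHom.finsetProd_apply]

lemma normPoint_map_galois (g : E ≃ₐ[L] E) (t : Points F A E) :
    normPoint F A E L (Points.map (g.restrictScalars F).toAlgHom t) = normPoint F A E L t := by
  rw [normPoint_apply, normPoint_apply]
  exact Fintype.prod_equiv (Equiv.mulRight g) _ _ fun h => rfl

lemma map_normPoint_galois (g : E ≃ₐ[L] E) (t : Points F A E) :
    Points.map (g.restrictScalars F).toAlgHom (normPoint F A E L t) = normPoint F A E L t := by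
  rw [normPoint_apply, map_prod]
  exact Fintype.prod_equiv (Equiv.mulLeft g) _ _ fun h => rfl

lemma exists_map_eq_normPoint [IsGalois L E] (t : Points F A E) :
    ∃ y : Points F A L, Points.map (IsScalarTower.toAlgHom F L E) y = normPoint F A E L t := by
  refine Points.exists_map_eq (algebraMap L E).injective fun a => ?_
  refine (IsGalois.mem_range_algebraMap_iff_fixed _).2 fun g => ?_
  exact congrArg (fun t : Points F A E => t.ofConv a) (map_normPoint_galois g t)

/-- Conjugation by a semilinear automorphism. -/
def conjAut (τE : E ≃ₐ[F] E) (τL : L ≃ₐ[F] L)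
    (h : ∀ x, algebraMap L E (τL x) = τE (algebraMap L E x)) (g : E ≃ₐ[L] E) : E ≃ₐ[L] E :=
  AlgEquiv.ofRingEquiv (f := (τE.toRingEquiv.trans g.toRingEquiv).trans τE.symm.toRingEquiv)
    fun x => by
      change τE.symm (g (τE (algebraMap L E x))) = _
      rw [← h, g.commutes, h, AlgEquiv.symm_apply_apply]

/-- Conjugation by `τE` permutes `Gal(E/L)`, hence the factors of the norm. -/
lemma normPoint_map_semilinear {τE : E ≃ₐ[F] E} {τL : L ≃ₐ[F] L}
    (h : ∀ x, algebraMap L E (τL x) = τE (algebraMap L E x)) (t : Points F A E) :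
    normPoint F A E L (Points.map τE.toAlgHom t) =
      Points.map τE.toAlgHom (normPoint F A E L t) := by
  have h' : ∀ x, algebraMap L E (τL.symm x) = τE.symm (algebraMap L E x) := fun x => by
    rw [AlgEquiv.eq_symm_apply, ← h, AlgEquiv.apply_symm_apply]
  rw [normPoint_apply, normPoint_apply, map_prod]
  refine Finset.prod_nbij' (conjAut τE τL h) (conjAut τE.symm τL.symm h')
    (fun _ _ => Finset.mem_univ _) (fun _ _ => Finset.mem_univ _) ?_ ?_ ?_
  · intro g _
    ext x
    change τE (τE.symm (g (τE (τE.symm x)))) = g x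
    simp
  · intro g _
    ext x
    change τE.symm (τE (g (τE.symm (τE x)))) = g x
    simp
  · intro g _
    refine Points.ext fun a => ?_
    change g (τE (t.ofConv a)) = τE (τE.symm (g (τE (t.ofConv a))))
    simp

variable {ord : Eˣ →* Multiplicative ℤ}

/-- The kernel of the Kottwitz homomorphism consists of the norms of integral points. -/
lemma mem_kottwitzKer_iff {K : Type*} [Field K] [Algebra F K] (j : K →ₐ[F] E)
    (hK : IsSplitOver F A K) (hord : Function.Surjective ord)
    (hinv : ∀ (g : E ≃ₐ[L] E) (x : Eˣ), ord (Units.map (g : E →* E) x) = ord x)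
    {y : Points F A L} : y ∈ (kottwitzGraph L ord).comap (MonoidHom.inl _ _) ↔
      ∃ t : Points F A E, normPoint F A E L t = Points.map (IsScalarTower.toAlgHom F L E) y ∧
        ordPoint ord t = 1 := by
  constructor
  · rintro ⟨t, ht⟩
    have h1 : normPoint F A E L t = Points.map (IsScalarTower.toAlgHom F L E) y :=
      congrArg Prod.fst ht
    have h2 : (QuotientGroup.mk (ordPoint ord t) : Coinvariants F A E L) = 1 :=
      congrArg Prod.snd ht
    rw [QuotientGroup.eq_one_iff] at h2
    -- Every cocharacter is `ordPoint ord u` for some `u`, so the generator `g x - x` is the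
    -- valuation of `g(u)/u`, which has trivial norm. Dividing `t` by such an element makes it
    -- integral without changing its norm.
    have hle : augmentation F A E L ≤ (normPoint F A E L).ker.map (ordPoint ord) := by
      rw [augmentation, Subgroup.closure_le]
      rintro _ ⟨g, x, rfl⟩
      obtain ⟨u, rfl⟩ := ordPoint_surjective j hK hord x
      refine ⟨Points.map (g.restrictScalars F).toAlgHom u / u, ?_, ?_⟩
      · rw [SetLike.mem_coe, MonoidHom.mem_ker, map_div, normPoint_map_galois, div_self']
      · rw [map_div, galCochar_ordPoint (g.restrictScalars F) (hinv g)]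
    obtain ⟨s, hs, hst⟩ := hle h2
    refine ⟨t / s, ?_, ?_⟩
    · rw [map_div, MonoidHom.mem_ker.1 hs, div_one, h1]
    · rw [map_div, hst, div_self']
  · rintro ⟨t, ht, hord⟩
    exact ⟨t, Prod.ext ht (by
      change (QuotientGroup.mk (ordPoint ord t) : Coinvariants F A E L) = 1
      rw [hord]
      rfl)⟩

/-- A telescoping product: if `φ = τ ^ m` and `φ s = t s`, then `t = τ s' / s'` for
`s' = s τ(s) ⋯ τ ^ (m - 1)(s)`. -/
lemma map_prod_pow_eq_mul (τ : E ≃ₐ[F] E) (m : ℕ) {s t : Points F A E}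
    (h : Points.map (τ ^ m).toAlgHom s = t * s) :
    Points.map τ.toAlgHom (∏ i ∈ Finset.range m, Points.map (τ ^ i).toAlgHom s) =
      t * ∏ i ∈ Finset.range m, Points.map (τ ^ i).toAlgHom s := by
  have h1 : ∀ i, Points.map τ.toAlgHom (Points.map (τ ^ i).toAlgHom s) =
      Points.map (τ ^ (i + 1)).toAlgHom s := fun i => by
    rw [pow_succ']; rfl
  have h0 : Points.map (τ ^ 0).toAlgHom s = s := rfl
  rw [map_prod, Finset.prod_congr rfl fun i _ => h1 i]
  apply mul_right_cancel (b := s)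
  have h2 := Finset.prod_range_succ' (fun i => Points.map (τ ^ i).toAlgHom s) m
  rw [Finset.prod_range_succ, h, h0] at h2
  rw [← h2]
  rw [mul_comm t s, mul_comm t, mul_assoc, mul_comm t s]

lemma kottwitzKer_map_mem {K : Type*} [Field K] [Algebra F K] (j : K →ₐ[F] E)
    (hK : IsSplitOver F A K) (hord : Function.Surjective ord)
    (hinv : ∀ (g : E ≃ₐ[L] E) (x : Eˣ), ord (Units.map (g : E →* E) x) = ord x)
    {τE : E ≃ₐ[F] E} {τL : L ≃ₐ[F] L}
    (h : ∀ x, algebraMap L E (τL x) = τE (algebraMap L E x))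
    (hτ : ∀ x, ord (Units.map (τE : E →* E) x) = ord x)
    {y : Points F A L} (hy : y ∈ (kottwitzGraph L ord).comap (MonoidHom.inl _ _)) :
    Points.map τL.toAlgHom y ∈ (kottwitzGraph L ord).comap (MonoidHom.inl _ _) := by
  obtain ⟨t, ht, hord1⟩ := (mem_kottwitzKer_iff j hK hord hinv).1 hy
  refine (mem_kottwitzKer_iff j hK hord hinv).2 ⟨Points.map τE.toAlgHom t, ?_,
    ordPoint_map_eq_one τE hτ hord1⟩
  rw [normPoint_map_semilinear h, ht]
  exact Points.ext fun a => (h _).symm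

/-- `τ - 1` is surjective on the kernel of the Kottwitz homomorphism, if some power of `τ` fixes the
splitting field and satisfies the analogous property for the units of `E`. -/
lemma exists_map_eq_mul_of_mem_kottwitzKer [IsGalois L E] {K : Type*} [Field K] [Algebra F K]
    (j : K →ₐ[F] E) (hK : IsSplitOver F A K) (hord : Function.Surjective ord)
    (hinv : ∀ (g : E ≃ₐ[L] E) (x : Eˣ), ord (Units.map (g : E →* E) x) = ord x)
    {τE : E ≃ₐ[F] E} {τL : L ≃ₐ[F] L}
    (h : ∀ x, algebraMap L E (τL x) = τE (algebraMap L E x))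
    (hτ : ∀ x, ord (Units.map (τE : E →* E) x) = ord x) (m : ℕ)
    (hm : ∀ x, (τE ^ m) (j x) = j x)
    (hsurj : ∀ u ∈ ord.ker, ∃ x ∈ ord.ker,
      Units.map ((τE ^ m : E ≃ₐ[F] E) : E →* E) x = u * x)
    {y : Points F A L} (hy : y ∈ (kottwitzGraph L ord).comap (MonoidHom.inl _ _)) :
    ∃ z ∈ (kottwitzGraph L ord).comap (MonoidHom.inl (Points F A L) (Coinvariants F A E L)),
      Points.map τL.toAlgHom z = y * z := by
  obtain ⟨t, ht, hord1⟩ := (mem_kottwitzKer_iff j hK hord hinv).1 hy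
  have hτi : ∀ (i : ℕ) (x : Eˣ), ord (Units.map ((τE ^ i : E ≃ₐ[F] E) : E →* E) x) = ord x := by
    intro i
    induction i with
    | zero => intro x; rfl
    | succ i ih =>
      intro x
      rw [pow_succ]
      exact (ih (Units.map (τE : E →* E) x)).trans (hτ x)
  obtain ⟨s, hs1, hs⟩ := exists_map_eq_mul_of_fixes j hK hm (hτi m) hsurj hord1
  have hs' := map_prod_pow_eq_mul τE m hs
  set s' := ∏ i ∈ Finset.range m, Points.map (τE ^ i).toAlgHom s
  have hs1' : ordPoint ord s' = 1 := by
    rw [map_prod]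
    exact Finset.prod_eq_one fun i _ => ordPoint_map_eq_one _ (hτi i) hs1
  -- The equation `τ s' = t s'` is solved over `E`. Its norm is the required equation over `L`.
  obtain ⟨z, hz⟩ := exists_map_eq_normPoint (L := L) s'
  refine ⟨z, (mem_kottwitzKer_iff j hK hord hinv).2 ⟨s', hz.symm, hs1'⟩, ?_⟩
  apply Points.map_injective (f := IsScalarTower.toAlgHom F L E) (algebraMap L E).injective
  have h1 : Points.map (IsScalarTower.toAlgHom F L E) (Points.map τL.toAlgHom z) =
      Points.map τE.toAlgHom (Points.map (IsScalarTower.toAlgHom F L E) z) :=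
    Points.ext fun a => h _
  rw [h1, hz, ← normPoint_map_semilinear h, hs', map_mul, map_mul, ht, hz]

end Kernel

/-! ### Restriction of automorphisms to stable subfields -/

section Restriction

variable {F : Type*} [Field F] {C S : Type*} [Field C] [Algebra F C] [Field S] [Algebra F S]

lemma exists_restrict (j : S →ₐ[F] C) (τ : C ≃ₐ[F] C) (h : ∀ x, ∃ y, j y = τ (j x))
    (h' : ∀ x, ∃ y, j y = τ.symm (j x)) : ∃ τS : S ≃ₐ[F] S, ∀ x, j (τS x) = τ (j x) := by
  choose f hf using h
  choose f' hf' using h'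
  have hj : Function.Injective j := j.injective
  refine ⟨AlgEquiv.ofRingEquiv (f := RingEquiv.mk ⟨f, f', fun x => ?_, fun x => ?_⟩
    (fun x y => ?_) (fun x y => ?_)) fun a => ?_, hf⟩
  · apply hj; rw [hf', hf, AlgEquiv.symm_apply_apply]
  · apply hj; rw [hf, hf', AlgEquiv.apply_symm_apply]
  · apply hj; simp [hf]
  · apply hj; simp [hf]
  · apply hj
    change j (f _) = _
    simp [hf]

lemma apply_pow_restrict {j : S →ₐ[F] C} {τ : C ≃ₐ[F] C} {τS : S ≃ₐ[F] S}
    (h : ∀ x, j (τS x) = τ (j x)) (n : ℕ) (x : S) : j ((τS ^ n) x) = (τ ^ n) (j x) := by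
  induction n generalizing x with
  | zero => rfl
  | succ n ih => rw [pow_succ, AlgEquiv.mul_apply, ih, h, pow_succ, AlgEquiv.mul_apply]

end Restriction

/-! ### Normalized valuations and the absolute value -/

section NormalizedOrd

variable {p : ℕ} [Fact p.Prime] {L : Type*} [Field L] [Algebra L ℂ_[p]]
  {E : IntermediateField L ℂ_[p]} {ord : Eˣ →* Multiplicative ℤ}

lemma IsNormalizedOrd.eq_one_iff (h : IsNormalizedOrd E ord) (x : Eˣ) :
    ord x = 1 ↔ ‖((x : E) : ℂ_[p])‖ = 1 := by
  have h1 := h.nonneg_iff x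
  have h2 := h.nonneg_iff x⁻¹
  have hx0 : ((x : E) : ℂ_[p]) ≠ 0 := fun h0 => x.ne_zero (Subtype.ext h0)
  have h3 : ‖(((x⁻¹ : Eˣ) : E) : ℂ_[p])‖ = ‖((x : E) : ℂ_[p])‖⁻¹ := by
    rw [Units.val_inv_eq_inv_val, ← norm_inv]
    rfl
  rw [h3, inv_le_one₀ (norm_pos_iff.2 hx0), map_inv, toAdd_inv] at h2
  have h4 : ord x = 1 ↔ (ord x).toAdd = 0 := Iff.rfl
  rw [h4]
  constructor
  · intro h0
    exact le_antisymm (h1.1 h0.ge) (h2.1 (by omega))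
  · intro h0
    have := h1.2 h0.le
    have := h2.2 h0.ge
    omega

lemma IsNormalizedOrd.eq_of_norm_eq (h : IsNormalizedOrd E ord) {x y : Eˣ}
    (hxy : ‖((x : E) : ℂ_[p])‖ = ‖((y : E) : ℂ_[p])‖) : ord x = ord y := by
  have hy0 : ((y : E) : ℂ_[p]) ≠ 0 := fun h0 => y.ne_zero (Subtype.ext h0)
  rw [← div_eq_one, ← map_div, h.eq_one_iff, Units.val_div_eq_div_val]
  change ‖((x : E) : ℂ_[p]) / ((y : E) : ℂ_[p])‖ = 1
  rw [norm_div, hxy, div_self (norm_ne_zero_iff.2 hy0)]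

/-- The constant is the absolute value of a uniformizer. It supplies the uniform contraction factor
in the approximation argument. -/
lemma IsNormalizedOrd.exists_discrete (h : IsNormalizedOrd E ord) :
    ∃ c : ℝ, 0 ≤ c ∧ c < 1 ∧ ∀ x ∈ E, ‖x‖ < 1 → ‖x‖ ≤ c := by
  obtain ⟨π, hπ⟩ := h.surjective (Multiplicative.ofAdd 1)
  have hπ0 : ((π : E) : ℂ_[p]) ≠ 0 := fun h0 => π.ne_zero (Subtype.ext h0)
  have hπ1 : (ord π).toAdd = 1 := by rw [hπ]; rfl
  refine ⟨‖((π : E) : ℂ_[p])‖, norm_nonneg _, ?_, fun x hx hlt => ?_⟩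
  · refine lt_of_le_of_ne ((h.nonneg_iff π).1 (by omega)) fun h1 => ?_
    have h2 : (ord π).toAdd = 0 := (h.eq_one_iff π).2 h1
    omega
  · by_cases hx0 : x = 0
    · simp [hx0]
    let u : Eˣ := Units.mk0 ⟨x, hx⟩ fun h0 => hx0 (congrArg Subtype.val h0)
    have h1 : 0 ≤ (ord u).toAdd := (h.nonneg_iff u).2 hlt.le
    have h2 : (ord u).toAdd ≠ 0 := fun h0 => hlt.ne ((h.eq_one_iff u).1 h0)
    have h3 := (h.nonneg_iff (u / π)).1 (by rw [map_div, toAdd_div]; omega)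
    rw [Units.val_div_eq_div_val] at h3
    change ‖x / ((π : E) : ℂ_[p])‖ ≤ 1 at h3
    rwa [norm_div, div_le_one (norm_pos_iff.2 hπ0)] at h3

end NormalizedOrd

/-! ### The action of Frobenius on `T(L)_1` -/

section Kottwitz

variable {p : ℕ} [Fact p.Prime] {F : Type*} [Field F] [Algebra ℚ_[p] F]
    [FiniteDimensional ℚ_[p] F] [Algebra F ℂ_[p]] [IsScalarTower ℚ_[p] F ℂ_[p]]
    {A : Type*} [CommRing A] [HopfAlgebra F A]

/-- The inclusion of `K` into `K L`. -/
def toCompositum (K : IntermediateField F ℂ_[p]) : K →ₐ[F] compositum K where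
  toFun x := ⟨x, IntermediateField.subset_adjoin _ _ x.2⟩
  map_one' := rfl
  map_mul' _ _ := rfl
  map_zero' := rfl
  map_add' _ _ := rfl
  commutes' _ := rfl

lemma exists_restrict_compositum (K : IntermediateField F ℂ_[p]) [Normal F K]
    {τ : ℂ_[p] ≃ₐ[F] ℂ_[p]} (hτ : ∀ x, ‖τ x‖ = ‖x‖) :
    ∃ τE : compositum K ≃ₐ[F] compositum K, ∀ x, ((τE x : compositum K) : ℂ_[p]) = τ x := by
  have hτ' : ∀ x, ‖τ.symm x‖ = ‖x‖ := fun x => by rw [← hτ, AlgEquiv.apply_symm_apply]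
  exact exists_restrict ((compositum K).val.restrictScalars F) τ
    (fun x => ⟨⟨τ x, map_mem_compositum K hτ x.2⟩, rfl⟩)
    (fun x => ⟨⟨τ.symm x, map_mem_compositum K hτ' x.2⟩, rfl⟩)

lemma exists_restrict_completedUnramified {τ : ℂ_[p] ≃ₐ[F] ℂ_[p]} (hτ : ∀ x, ‖τ x‖ = ‖x‖) :
    ∃ τL : completedUnramified p F ≃ₐ[F] completedUnramified p F,
      ∀ x, ((τL x : completedUnramified p F) : ℂ_[p]) = τ x := by
  have hτ' : ∀ x, ‖τ.symm x‖ = ‖x‖ := fun x => by rw [← hτ, AlgEquiv.apply_symm_apply]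
  exact exists_restrict (completedUnramified p F).val τ
    (fun x => ⟨⟨τ x, map_mem_completedUnramified hτ x.2⟩, rfl⟩)
    (fun x => ⟨⟨τ.symm x, map_mem_completedUnramified hτ' x.2⟩, rfl⟩)

variable [Coalgebra.IsCocomm F A]

lemma SplittingDatum.map_mem_kottwitzKer (D : SplittingDatum p F A) {τ : ℂ_[p] ≃ₐ[F] ℂ_[p]}
    (hτ : ∀ x, ‖τ x‖ = ‖x‖) {τL : completedUnramified p F ≃ₐ[F] completedUnramified p F}
    (hτL : ∀ x, ((τL x : completedUnramified p F) : ℂ_[p]) = τ x)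
    {y : Points F A (completedUnramified p F)} (hy : y ∈ D.kottwitzKer) :
    Points.map τL.toAlgHom y ∈ D.kottwitzKer := by
  have := D.finite
  have := D.galois
  obtain ⟨τE, hτE⟩ := exists_restrict_compositum D.K hτ
  refine kottwitzKer_map_mem (toCompositum D.K) D.split D.isNormalizedOrd.surjective
    (fun g x => D.isNormalizedOrd.eq_of_norm_eq (norm_galois_compositum D.K g x))
    (τE := τE) ?_ (fun x => D.isNormalizedOrd.eq_of_norm_eq ?_) hy
  · intro x
    apply Subtype.ext
    rw [hτE]
    exact hτL x
  · exact (congrArg (‖·‖) (hτE x)).trans (hτ _)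

/-- A power `τ ^ m` with `m ≠ 0` is trivial on the splitting field, and it is a Frobenius power with
exponent `Q ^ m > 1`, so the result on units of `K L` applies to it. -/
lemma SplittingDatum.exists_map_eq_mul (D : SplittingDatum p F A) {τ : ℂ_[p] ≃ₐ[F] ℂ_[p]} {Q : ℕ}
    (hτ : IsFrobeniusPower τ Q) (hQ : 1 < Q)
    {τL : completedUnramified p F ≃ₐ[F] completedUnramified p F}
    (hτL : ∀ x, ((τL x : completedUnramified p F) : ℂ_[p]) = τ x)
    {y : Points F A (completedUnramified p F)} (hy : y ∈ D.kottwitzKer) :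
    ∃ z ∈ D.kottwitzKer, Points.map τL.toAlgHom z = y * z := by
  have := D.finite
  have := D.galois
  obtain ⟨τE, hτE⟩ := exists_restrict_compositum D.K hτ.norm
  obtain ⟨m, hm0, hm⟩ := exists_pow_apply_eq_self D.K τ
  have hpow : ∀ x, (((τE ^ m) x : compositum D.K) : ℂ_[p]) = (τ ^ m) x :=
    apply_pow_restrict (j := (compositum D.K).val.restrictScalars F) hτE m
  obtain ⟨c, hc0, hc, hdisc⟩ := D.isNormalizedOrd.exists_discrete
  refine exists_map_eq_mul_of_mem_kottwitzKer (toCompositum D.K) D.split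
    D.isNormalizedOrd.surjective
    (fun g x => D.isNormalizedOrd.eq_of_norm_eq (norm_galois_compositum D.K g x))
    (τE := τE) ?_ (fun x => D.isNormalizedOrd.eq_of_norm_eq ?_) m ?_ ?_ hy
  · intro x
    apply Subtype.ext
    rw [hτE]
    exact hτL x
  · exact (congrArg (‖·‖) (hτE x)).trans (hτ.norm _)
  · intro x
    apply Subtype.ext
    rw [hpow]
    exact hm x x.2
  · intro u hu
    obtain ⟨x, hxE, hx1, hx⟩ := (hτ.pow m).exists_apply_eq_mul (Nat.one_lt_pow hm0 hQ)
      (S := (compositum D.K).toSubfield) (isClosed_compositum D.K)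
      (fun x hx => map_mem_compositum D.K (hτ.pow m).norm hx)
      (fun ζ hζ => algebraMap_mem_compositum D.K hζ.mem_completedUnramified) hc0 hc hdisc
      (u : compositum D.K).2 ((D.isNormalizedOrd.eq_one_iff u).1 hu)
    have hx0 : x ≠ 0 := norm_ne_zero_iff.1 (by rw [hx1]; exact one_ne_zero)
    refine ⟨Units.mk0 ⟨x, hxE⟩ fun h0 => hx0 (congrArg Subtype.val h0),
      (D.isNormalizedOrd.eq_one_iff _).2 hx1, Units.ext (Subtype.ext ?_)⟩
    exact (hpow ⟨x, hxE⟩).trans hx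

lemma map_mem_kottwitzKer {τ : ℂ_[p] ≃ₐ[F] ℂ_[p]} (hτ : ∀ x, ‖τ x‖ = ‖x‖)
    {τL : completedUnramified p F ≃ₐ[F] completedUnramified p F}
    (hτL : ∀ x, ((τL x : completedUnramified p F) : ℂ_[p]) = τ x)
    {y : Points F A (completedUnramified p F)} (hy : y ∈ kottwitzKer p F A) :
    Points.map τL.toAlgHom y ∈ kottwitzKer p F A := by
  have hle : kottwitzKer p F A ≤ (kottwitzKer p F A).comap (Points.map τL.toAlgHom) :=
    iSup_le fun D _ hz => (le_iSup (fun D : SplittingDatum p F A => D.kottwitzKer) D)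
      (D.map_mem_kottwitzKer hτ hτL hz)
  exact hle hy

/-- Lang's theorem for `T(L)_1`. -/
lemma exists_map_eq_mul_of_mem {τ : ℂ_[p] ≃ₐ[F] ℂ_[p]} {Q : ℕ}
    (hτ : IsFrobeniusPower τ Q) (hQ : 1 < Q)
    {τL : completedUnramified p F ≃ₐ[F] completedUnramified p F}
    (hτL : ∀ x, ((τL x : completedUnramified p F) : ℂ_[p]) = τ x)
    {y : Points F A (completedUnramified p F)} (hy : y ∈ kottwitzKer p F A) :
    ∃ z ∈ kottwitzKer p F A, Points.map τL.toAlgHom z = y * z := by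
  let δ : Points F A (completedUnramified p F) →* Points F A (completedUnramified p F) :=
    Points.map τL.toAlgHom / MonoidHom.id _
  -- Since `T(L)` is commutative, `δ` is a homomorphism, so the image of the supremum is a subgroup
  -- and it is enough to treat each splitting datum separately.
  have hle : kottwitzKer p F A ≤ (kottwitzKer p F A).map δ := by
    refine iSup_le fun D w hw => ?_
    obtain ⟨z, hz, h⟩ := D.exists_map_eq_mul hτ hQ hτL hw
    refine ⟨z, le_iSup (fun D : SplittingDatum p F A => D.kottwitzKer) D hz, ?_⟩
    change Points.map τL.toAlgHom z / z = w
    rw [h, mul_div_cancel_right]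
  obtain ⟨z, hz, h⟩ := hle hy
  refine ⟨z, hz, ?_⟩
  rw [← h]
  exact (div_mul_cancel _ _).symm

end Kottwitz

section Norm

lemma prod_range_pow_eq_prod_univ {G M : Type*} [Group G] [Fintype G] [CommMonoid M] {g : G}
    (hg : ∀ x, x ∈ Subgroup.zpowers g) {r : ℕ} (hr : Nat.card G = r) (f : G → M) :
    ∏ i ∈ Finset.range r, f (g ^ i) = ∏ x, f x := by
  classical
  rw [← hr, ← IsCyclic.image_range_card hg, Finset.prod_image]
  rw [← orderOf_eq_card_of_forall_mem_zpowers hg]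
  exact fun i hi j hj h => pow_injOn_Iio_orderOf (by simpa using hi) (by simpa using hj) h

end Norm

end PadicTorus

end

open PadicTorus in
/-- `F` is a `p`-adic field embedded in `ℂ_p`, `T = Spec A` an `F`-torus, `F_r` the unramified
extension of `F` of degree `r`, and `θ` a generator of `Gal(F_r/F)`. The norm
`t ↦ t θ(t) ⋯ θ^(r-1)(t)` is a surjective homomorphism `T(F_r)_1 → T(F)_1`. -/
theorem lemma8 (p : ℕ) [Fact p.Prime] (F : Type*) [Field F] [Algebra ℚ_[p] F]
    [FiniteDimensional ℚ_[p] F] [Algebra F ℂ_[p]] [IsScalarTower ℚ_[p] F ℂ_[p]]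
    (A : Type*) [CommRing A] [HopfAlgebra F A] [Coalgebra.IsCocomm F A]
    (hT : PadicTorus.IsTorus F A)
    (r : ℕ) (Fr : IntermediateField F ℂ_[p]) [FiniteDimensional F Fr]
    (hFr : PadicTorus.IsUnramified Fr) (hr : Module.finrank F Fr = r)
    (θ : Fr ≃ₐ[F] Fr) (hθ : ∀ g : Fr ≃ₐ[F] Fr, g ∈ Subgroup.zpowers θ) :
    ∃ N : PadicTorus.pointsOne A
          (IntermediateField.inclusion (PadicTorus.le_completedUnramified Fr hFr)) →*
        PadicTorus.pointsOne A (Algebra.ofId F (PadicTorus.completedUnramified p F)),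
      (∀ t, PadicTorus.Points.map (Algebra.ofId F Fr) (N t : PadicTorus.Points F A F) =
        ∏ i ∈ Finset.range r,
          PadicTorus.Points.map (θ ^ i).toAlgHom (t : PadicTorus.Points F A Fr)) ∧
      Function.Surjective N := by
  have := hFr.isGalois
  obtain ⟨σ, hσn, hσt⟩ := exists_frobenius p F
  have hσ : IsFrobeniusPower σ (baseCard p F) := ⟨hσn, hσt⟩
  obtain ⟨hgen, hcard⟩ := hFr.frobenius_generates hσ
  set s := σ.restrictNormal Fr with hs
  rw [hr] at hcard
  have hr0 : r ≠ 0 := hr ▸ Module.finrank_pos.ne'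
  have hQ : 1 < baseCard p F ^ r := Nat.one_lt_pow hr0 baseCard_pos
  obtain ⟨σL, hσL⟩ := exists_restrict_completedUnramified hσn
  have hσLr : ∀ x, (((σL ^ r) x : completedUnramified p F) : ℂ_[p]) = (σ ^ r) x :=
    apply_pow_restrict (j := (completedUnramified p F).val) hσL r
  set ι := IntermediateField.inclusion (le_completedUnramified Fr hFr) with hι
  have hιinj : Function.Injective ι := ι.injective
  have hcardG : Nat.card (Fr ≃ₐ[F] Fr) = r := by rw [IsGalois.card_aut_eq_finrank, hr]
  have hιs : ∀ (i : ℕ) (t : Points F A Fr), Points.map ι (Points.map (s ^ i).toAlgHom t) =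
      Points.map (σL ^ i).toAlgHom (Points.map ι t) := by
    intro i t
    refine Points.ext fun a => Subtype.ext ?_
    have h1 := apply_pow_restrict (j := Fr.val) (τ := σ) (τS := s)
      (fun x => AlgEquiv.restrictNormal_commutes σ Fr x) i (t.ofConv a)
    have h2 := apply_pow_restrict (j := (completedUnramified p F).val) hσL i (ι (t.ofConv a))
    exact h1.trans h2.symm
  -- Both products run over all of `Gal(F_r/F)`, so `θ` may be replaced by Frobenius.
  have hprod : ∀ t : Points F A Fr, ∏ i ∈ Finset.range r, Points.map (θ ^ i).toAlgHom t =
      ∏ i ∈ Finset.range r, Points.map (s ^ i).toAlgHom t := by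
    intro t
    rw [prod_range_pow_eq_prod_univ hθ hcardG fun g => Points.map g.toAlgHom t,
      prod_range_pow_eq_prod_univ hgen hcardG fun g => Points.map g.toAlgHom t]
  have hιprod : ∀ t : Points F A Fr,
      Points.map ι (∏ i ∈ Finset.range r, Points.map (θ ^ i).toAlgHom t) =
        ∏ i ∈ Finset.range r, Points.map (σL ^ i).toAlgHom (Points.map ι t) := by
    intro t
    rw [hprod, map_prod]
    exact Finset.prod_congr rfl fun i _ => hιs i t
  have hbase : ∀ n : Points F A F, Points.map ι (Points.map (Algebra.ofId F Fr) n) =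
      Points.map (Algebra.ofId F (completedUnramified p F)) n := fun n =>
    Points.ext fun a => ι.commutes _
  have hmem : ∀ (i : ℕ) (y : Points F A (completedUnramified p F)), y ∈ kottwitzKer p F A →
      Points.map (σL ^ i).toAlgHom y ∈ kottwitzKer p F A := fun i y hy =>
    map_mem_kottwitzKer (hσ.pow i).norm
      (apply_pow_restrict (j := (completedUnramified p F).val) hσL i) hy
  let f : pointsOne A ι →* Points F A Fr :=
    (∏ i ∈ Finset.range r, Points.map (θ ^ i).toAlgHom).comp (pointsOne A ι).subtype
  have hf : ∀ t, f t = ∏ i ∈ Finset.range r, Points.map (θ ^ i).toAlgHom (t : Points F A Fr) :=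
    fun t => MonoidHom.finsetProd_apply _ _ _
  let g : pointsOne A (Algebra.ofId F (completedUnramified p F)) →* Points F A Fr :=
    (Points.map (Algebra.ofId F Fr)).comp
      (pointsOne A (Algebra.ofId F (completedUnramified p F))).subtype
  have hg : Function.Injective g :=
    (Points.map_injective (algebraMap F Fr).injective).comp Subtype.val_injective
  have hfg : ∀ t, f t ∈ g.range := by
    intro t
    obtain ⟨n, hn⟩ : ∃ n : Points F A F, Points.map (Algebra.ofId F Fr) n = f t := by
      refine Points.exists_map_eq (algebraMap F Fr).injective fun a => ?_
      refine (IsGalois.mem_range_algebraMap_iff_fixed _).2 fun h => ?_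
      have hfix : Points.map h.toAlgHom (f t) = f t := by
        rw [hf, prod_range_pow_eq_prod_univ hθ hcardG
          fun g => Points.map g.toAlgHom (t : Points F A Fr), map_prod]
        exact Fintype.prod_equiv (Equiv.mulLeft h) _ _ fun h' => rfl
      exact congrArg (fun t : Points F A Fr => t.ofConv a) hfix
    refine ⟨⟨n, ?_⟩, hn⟩
    change Points.map (Algebra.ofId F (completedUnramified p F)) n ∈ kottwitzKer p F A
    rw [← hbase, hn, hf, hιprod]
    exact prod_mem fun i _ => hmem i _ t.2
  let N := (MonoidHom.ofInjective hg).symm.toMonoidHom.comp (f.codRestrict g.range hfg)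
  have hN : ∀ t, g (N t) = f t := fun t =>
    congrArg Subtype.val ((MonoidHom.ofInjective hg).apply_symm_apply ⟨f t, hfg t⟩)
  refine ⟨N, fun t => (hN t).trans (hf t), fun n => ?_⟩
  -- Lang's theorem is applied to `σ ^ r` rather than `σ`, so that the telescoping norm of `σ(y)/y`
  -- is exactly `n`.
  obtain ⟨y, hy, hyn⟩ := exists_map_eq_mul_of_mem (hσ.pow r) hQ hσLr
    (y := Points.map (Algebra.ofId F (completedUnramified p F)) (n : Points F A F)) n.2
  set y₀ := Points.map (Algebra.ofId F (completedUnramified p F)) (n : Points F A F) with hy₀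
  have hy₀σ : Points.map σL.toAlgHom y₀ = y₀ := Points.ext fun a => σL.commutes _
  let x := Points.map σL.toAlgHom y / y
  have hx : x ∈ kottwitzKer p F A := div_mem (by simpa using hmem 1 y hy) hy
  have hcomm : Points.map (σL ^ r).toAlgHom (Points.map σL.toAlgHom y) =
      Points.map σL.toAlgHom (Points.map (σL ^ r).toAlgHom y) := by
    refine Points.ext fun a => ?_
    change (σL ^ r * σL) _ = (σL * σL ^ r) _
    rw [← pow_succ, ← pow_succ']
  -- `σ^r` takes `y` to `y₀ y`, and `σ` fixes `y₀`, so the factor `y₀` cancels in `σ(y)/y`.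
  have hxfix : Points.map (σL ^ r).toAlgHom x = x := by
    simp only [x]
    rw [map_div, hcomm, hyn, map_mul, hy₀σ, mul_div_mul_left_eq_div]
  -- The residue field of `F_r` has `q ^ r` elements, so elements of `L` fixed by `σ ^ r` lie in
  -- `F_r`.
  obtain ⟨t, ht⟩ : ∃ t : Points F A Fr, Points.map ι t = x := by
    refine Points.exists_map_eq hιinj fun a => ?_
    have h1 : (σ ^ r) ((x.ofConv a : completedUnramified p F) : ℂ_[p]) =
        ((x.ofConv a : completedUnramified p F) : ℂ_[p]) := by
      rw [← hσLr]
      exact congrArg (fun t : Points F A (completedUnramified p F) => (t.ofConv a).1) hxfix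
    have h2 := hFr.mem_of_fixed (hcard ▸ hσ.pow r) (x.ofConv a).2 h1
    exact ⟨⟨_, h2⟩, rfl⟩
  refine ⟨⟨t, by change Points.map ι t ∈ kottwitzKer p F A; rwa [ht]⟩, hg ?_⟩
  rw [hN]
  apply Points.map_injective hιinj
  rw [hf, hιprod]
  change _ = Points.map ι (Points.map (Algebra.ofId F Fr) (n : Points F A F))
  rw [hbase, ← hy₀, ht]
  have htel : ∀ i, Points.map (σL ^ i).toAlgHom x =
      Points.map (σL ^ (i + 1)).toAlgHom y / Points.map (σL ^ i).toAlgHom y := by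
    intro i
    simp only [x]
    rw [map_div, pow_succ]
    rfl
  rw [Finset.prod_congr rfl fun i _ => htel i,
    Finset.prod_range_div (fun i => Points.map (σL ^ i).toAlgHom y), hyn]
  exact mul_div_cancel_right _ _
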